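/- Conventions. A permutation of a finite set $U$ of integers, $|U|=k$, is written as a word $w=w_1\cdots w_k$ containing each letter of $U$ exactly once; its descent set is $\mathrm{Des}(w)=\{i: w_i>w_{i+1}\}\subseteq\{1,\dots,k-1\}$. For $D\subseteq\{1,\dots,k-1\}$ let $$F_{k,D}=\sum_{\substack{i_1\le i_2\le\cdots\le i_k\\ i_j<i_{j+1}\text{ if }j\in D}}x_{i_1}x_{i_2}\cdots x_{i_k}$$ be Gessel's fundamental quasisymmetric function, and for a finite multiset $A$ of permutations of $U$ let $\mathcal Q(A)=\sum_{w\in A}F_{k,\mathrm{Des}(w)}$, summed with multiplicities. The multiset $A$ is *fine* if $\mathcal Q(A)$ is a symmetric function that is Schur-positive, i.e. a linear combination of Schur functions with nonnegative coefficients. It is *fine for a (finite-dimensional) complex representation* $\rho$ of $S_k$ if $\mathrm{ch}(\chi^\rho)=\mathcal Q(A)$, where $\chi^\rho$ is the character of $\rho$ and $\mathrm{ch}$ is the Frobenius characteristic, $\mathrm{ch}(\chi)=\frac1{k!}\sum_{w\in S_k}\chi(w)\,p_{\mathrm{type}(w)}$ (equivalently, $\mathrm{ch}(\sum_\lambda c_\lambda\chi^\lambda)=\sum_\lambda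 c_\lambda s_\lambda$). Sets are regarded as multisets without repetitions. If $U_1,\dots,U_m$ are pairwise disjoint finite letter sets and $\sigma_i$ is a permutation of $U_i$, a *shuffle* of $\sigma_1,\dots,\sigma_m$ is a permutation of $U_1\sqcup\cdots\sqcup U_m$ in which, for every $i$, the letters of $U_i$ appear in the same order as in $\sigma_i$. For multisets $A_i$ of permutations of $U_i$, let $A_1\mathbin{\sqcup\!\sqcup}\cdots\mathbin{\sqcup\!\sqcup}A_m$ be the multiset of all shuffles of $\sigma_1,\dots,\sigma_m$ with $\sigma_i\in A_i$, with multiplicities. **Lemma.** 1. Let $U\sqcup V=[n]$ with $|U|=k$, and let $A$ and $B$ be multisets of permutations of $U$ and $V$, respectively. Then $A\mathbin{\sqcup\!\sqcup}B$ is a multiset of permutations of $[n]$, and it is a set if $A$ and $B$ are sets. If $A$ and $B$ are fine, then $A\mathbin{\sqcup\!\sqcup}B$ is fine and $$\mathcal Q(A\mathbin{\sqcup\!\sqcup}B)=\mathcal Q(A)\,\mathcal Q(B).$$ If $A$ is fine for the $S_k$-representation $\phi$ and $B$ is fine for the $S_{n-k}$-representation $\psi$, then $A\mathbin{\sqcup\!\sqcup}B$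 is fine for the induced representation $(\phi\otimes\psi)\uparrow_{S_k\times S_{n-k}}^{S_n}$, where $S_k$ permutes the first $k$ and $S_{n-k}$ the last $n-k$ letters of $[n]$. 2. More generally, let $n=\eta_1+\cdots+\eta_m$, let $U_1\sqcup\cdots\sqcup U_m=[n]$ with $|U_i|=\eta_i$, and let $A_i$ be a multiset of permutations of $U_i$ for each $i$. Then $A_1\mathbin{\sqcup\!\sqcup}\cdots\mathbin{\sqcup\!\sqcup}A_m$ is a multiset of permutations of $[n]$, and it is a set if all $A_i$ are sets. If all $A_i$ are fine, then $A_1\mathbin{\sqcup\!\sqcup}\cdots\mathbin{\sqcup\!\sqcup}A_m$ is fine and $\mathcal Q(A_1\mathbin{\sqcup\!\sqcup}\cdots\mathbin{\sqcup\!\sqcup}A_m)=\prod_{i=1}^m\mathcal Q(A_i)$. If each $A_i$ is fine for the $S_{\eta_i}$-representation $\phi_i$, then $A_1\mathbin{\sqcup\!\sqcup}\cdots\mathbin{\sqcup\!\sqcup}A_m$ is fine for the induced representation $\bigl(\bigotimes_{i=1}^m\phi_i\bigr)\uparrow_{S_{\eta_1}\times\cdots\times S_{\eta_m}}^{S_n}$,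 where the factors permute consecutive blocks of letters of $[n]$. -/

import Mathlib

open scoped TensorProduct

noncomputable section

namespace ShuffleFine

/-! ### Permutations of a letter set, written as words, and their shuffles -/

section Words

variable {α : Type*} [LinearOrder α]

/-- `w` is (the one-line notation of) a permutation of the finite letter set `U`:
every letter of `U` occurs in `w` exactly once, and no other letter occurs. -/
def IsPermOf (U : Finset α) (w : List α) : Prop :=
  w.Nodup ∧ w.toFinset = U

/-- The descent set `{i : w_i > w_{i+1}} ⊆ {1, …, |w| - 1}` of a word `w = w_1 w_2 ⋯`.
(The list `w` is indexed from `0`, so `w_i` is `w[i - 1]`.) -/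
def Des (w : List α) : Finset ℕ :=
  (Finset.Ico 1 w.length).filter fun i => ∃ h : i < w.length, w[i] < w[i - 1]

/-- The set of shuffles of two words `σ`, `τ` without common letters: all arrangements of the
letters of `σ` and `τ` in which the letters of `σ` appear in the same order as in `σ` and
the letters of `τ` appear in the same order as in `τ`. -/
def shuffles (σ τ : List α) : Finset (List α) :=
  ((σ : Multiset α) + (τ : Multiset α)).lists.toFinset.filter fun π =>
    π.filter (fun a => a ∈ σ) = σ ∧ π.filter (fun a => a ∈ τ) = τ

theorem mem_shuffles {σ τ π : List α} :
    π ∈ shuffles σ τ ↔ π.Perm (σ ++ τ) ∧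
      π.filter (fun a => a ∈ σ) = σ ∧ π.filter (fun a => a ∈ τ) = τ := by
  simp [shuffles]

/-- The shuffle of two multisets of words: the multiset of all shuffles of a word of
`A` with a word of `B`, with multiplicities. -/
def shuffle (A B : Multiset (List α)) : Multiset (List α) :=
  A.bind fun σ => B.bind fun τ => (shuffles σ τ).val

/-- The set of shuffles of a finite family of words `σ i` on pairwise disjoint sets of
letters. -/
def familyShuffles {m : ℕ} (σ : Fin m → List α) : Finset (List α) :=
  (∑ i, (σ i : Multiset α)).lists.toFinset.filter fun π =>
    ∀ i, π.filter (fun a => a ∈ σ i) = σ i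

theorem mem_familyShuffles {m : ℕ} {σ : Fin m → List α} {π : List α} :
    π ∈ familyShuffles σ ↔ (π : Multiset α) = ∑ i, (σ i : Multiset α) ∧
      ∀ i, π.filter (fun a => a ∈ σ i) = σ i := by
  simp [familyShuffles, Multiset.mem_lists_iff, eq_comm]

/-- The shuffle of a finite family of multisets of words: the multiset of all shuffles of a
family `σ` with `σ i` taken from `A i`, with multiplicities. -/
def familyShuffle {m : ℕ} (A : Fin m → Multiset (List α)) : Multiset (List α) :=
  (Multiset.pi Finset.univ.val A).bind fun σ =>
    (familyShuffles fun i => σ i (Finset.mem_univ i)).val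

end Words

/-! ### Symmetric and quasisymmetric functions in the variables `x_0, x_1, x_2, …` -/

/-- Gessel's fundamental quasisymmetric function `F_{n,D}`: the sum of
`x_{i_1} ⋯ x_{i_n}` over all `i_1 ≤ i_2 ≤ ⋯ ≤ i_n` such that `i_j < i_{j+1}` whenever `j ∈ D`.
(With `f : Fin n → ℕ` indexed from `0`, `i_j` is `f (j - 1)`.) -/
def fundamentalQSym (n : ℕ) (D : Finset ℕ) : MvPowerSeries ℕ ℂ := fun d =>
  (Nat.card {f : Fin n → ℕ // Monotone f ∧
    (∀ (j : ℕ) (h : j + 1 < n), j + 1 ∈ D → f ⟨j, by omega⟩ < f ⟨j + 1, h⟩) ∧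
    ∑ j, Finsupp.single (f j) 1 = d} : ℂ)

/-- The quasisymmetric function `𝓠(A) = ∑_{w ∈ A} F_{|w|, Des w}` of a multiset of words,
with multiplicities. -/
def Q {α : Type*} [LinearOrder α] (A : Multiset (List α)) : MvPowerSeries ℕ ℂ :=
  (A.map fun w => fundamentalQSym w.length (Des w)).sum

/-- The Schur function `s_μ`: the sum of `x^T` over all semistandard Young tableaux `T` of
shape `μ`. -/
def schur (μ : YoungDiagram) : MvPowerSeries ℕ ℂ := fun d =>
  (Nat.card {T : SemistandardYoungTableau μ //
    ∑ c ∈ μ.cells, Finsupp.single (T c.1 c.2) 1 = d} : ℂ)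

/-- Invariance under all permutations of the variables. -/
def IsSymmetricFunction (f : MvPowerSeries ℕ ℂ) : Prop :=
  ∀ (e : Equiv.Perm ℕ) (d : ℕ →₀ ℕ),
    MvPowerSeries.coeff (d.mapDomain e) f = MvPowerSeries.coeff d f

/-- `f` is a finite linear combination of Schur functions with nonnegative real coefficients. -/
def IsSchurPositive (f : MvPowerSeries ℕ ℂ) : Prop :=
  ∃ c : YoungDiagram →₀ ℝ, (∀ μ, 0 ≤ c μ) ∧ f = c.sum fun μ a => (a : ℂ) • schur μ

/-- A multiset of words is fine if its quasisymmetric function is symmetric and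
Schur-positive. -/
def IsFine {α : Type*} [LinearOrder α] (A : Multiset (List α)) : Prop :=
  IsSymmetricFunction (Q A) ∧ IsSchurPositive (Q A)

/-- The power sum `p_k = ∑_i x_i ^ k` (used for `k ≥ 1` only). -/
def powerSum (k : ℕ) : MvPowerSeries ℕ ℂ := fun d =>
  open Classical in if ∃ i, d = Finsupp.single i k then 1 else 0

/-- The Frobenius characteristic `ch(χ) = (1 / n!) ∑_{w ∈ S_n} χ(w) p_{type(w)}` of the character
`χ = tr ρ` of a complex representation `ρ` of `S_n`. The cycle type of `w`
is the partition of `n` that includes the fixed points of `w` as parts `1`. -/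
def frobeniusCh {n : ℕ} {V : Type*} [AddCommGroup V] [Module ℂ V]
    (ρ : Representation ℂ (Equiv.Perm (Fin n)) V) : MvPowerSeries ℕ ℂ :=
  ((n.factorial : ℂ)⁻¹) • ∑ w : Equiv.Perm (Fin n),
    LinearMap.trace ℂ V (ρ w) • (w.partition.parts.map powerSum).prod

/-- The multiset `A` is fine for the representation `ρ` of `S_n`. -/
def IsFineFor {n : ℕ} {V : Type*} [AddCommGroup V] [Module ℂ V]
    (ρ : Representation ℂ (Equiv.Perm (Fin n)) V)
    {α : Type*} [LinearOrder α] (A : Multiset (List α)) : Prop :=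
  frobeniusCh ρ = Q A

/-! ### Young subgroups and outer tensor products -/

/-- The embedding `S_k × S_l → S_{k+l}`, where `S_k` permutes the first `k` letters and `S_l` the
last `l` letters. -/
def youngEmb (k l : ℕ) :
    Equiv.Perm (Fin k) × Equiv.Perm (Fin l) →* Equiv.Perm (Fin (k + l)) :=
  (finSumFinEquiv.permCongrHom.toMonoidHom).comp (Equiv.Perm.sumCongrHom (Fin k) (Fin l))

/-- The embedding `S_{η_1} × ⋯ × S_{η_m} → S_n`, `n = η_1 + ⋯ + η_m`, where the factors
permute consecutive blocks of letters. -/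
def familyYoungEmb {m : ℕ} (η : Fin m → ℕ) :
    (∀ i, Equiv.Perm (Fin (η i))) →* Equiv.Perm (Fin (∑ i, η i)) :=
  (finSigmaFinEquiv.permCongrHom.toMonoidHom).comp
    (Equiv.Perm.sigmaCongrRightHom fun i => Fin (η i))

/-- The representation `φ ⊗ ψ` of `G × H` on `V ⊗ W`. -/
def outerTensor {G H V W : Type*} [Group G] [Group H] [AddCommGroup V] [Module ℂ V]
    [AddCommGroup W] [Module ℂ W] (φ : Representation ℂ G V) (ψ : Representation ℂ H W) :
    Representation ℂ (G × H) (V ⊗[ℂ] W) :=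
  Representation.tprod (φ.comp (MonoidHom.fst G H)) (ψ.comp (MonoidHom.snd G H))

/-- The representation `⨂ φ_i` of `∏ G_i` on `⨂ V_i`. -/
def familyOuterTensor {m : ℕ} {G V : Fin m → Type*} [∀ i, Group (G i)]
    [∀ i, AddCommGroup (V i)] [∀ i, Module ℂ (V i)] (φ : ∀ i, Representation ℂ (G i) (V i)) :
    Representation ℂ (∀ i, G i) (⨂[ℂ] i, V i) where
  toFun g := PiTensorProduct.map fun i => φ i (g i)
  map_one' := by
    simp only [Pi.one_apply, map_one]
    exact PiTensorProduct.map_one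
  map_mul' g h := by
    simp only [Pi.mul_apply, map_mul]
    exact PiTensorProduct.map_mul _ _

end ShuffleFine

end

/-! Everything rests on the multiplicativity of `Q`. Set all but the first `N` variables to zero.
The fundamental function of a word `w` then enumerates the labelings of its letters by numbers below
`N` for which `w` is sorted by label, ties being broken by the letters themselves
(`truncVars_fundamentalQSym`). A labeling of the whole alphabet has exactly one sorted word, and
that word is a shuffle of the `σ i` if and only if every `σ i` is sorted
(`card_filter_sorted_shuffles`). A labeling of the alphabet is a tuple of labelings of the blocks,
so the fundamental functions of the shuffles add up to the product (`sum_fundamentalQSym_shuffles`);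
distributivity gives `Q_shuffle` and `Q_familyShuffle`.

Fineness also needs products of Schur functions to be Schur-positive. This is Stembridge's
involution proof of the Littlewood–Richardson rule, with tableaux encoded as Gelfand–Tsetlin
patterns. Bender–Knuth toggles make Schur polynomials symmetric, so alternant times Schur polynomial
is a sum of alternants over patterns (`alternant_mul_gtSchur`). Toggling only the columns left of
the rightmost failure of the partition condition cancels all other terms (`sum_alternant_bad`). With
`λ = 0` this is the bialternant formula; cancelling the Vandermonde determinant then expands a
product of Schur polynomials (`gtSchur_mul_gtSchur`). The index set is the same for all large `N`
(`lrPatterns_eq_of_le`), so the expansion lifts to Schur functions.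

For representations, averaging over the subgroup computes the characteristic of an induced
representation (`frobeniusCh_ind`). Traces multiply on tensor products and cycle types add in Young
subgroups, so the characteristic is the product of the characteristics, which is the product of the
`Q (A i)`. -/

noncomputable section

namespace ShuffleFine

/-! ### Gelfand–Tsetlin patterns -/

/-- `x` is a Gelfand–Tsetlin pattern with top row `μ` reached at level `N`. It encodes the
semistandard tableau of shape `μ` with entries `< N` in which `x i r` is the number of
entries `< i` in row `r`. -/
structure IsGT (μ : ℕ → ℕ) (N : ℕ) (x : ℕ → ℕ → ℕ) : Prop where
  zero : ∀ r, x 0 r = 0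
  mono : ∀ i r, x i r ≤ x (i + 1) r
  interlace : ∀ i r, x (i + 1) (r + 1) ≤ x i r
  top : ∀ i r, N ≤ i → x i r = μ r

namespace IsGT

variable {μ : ℕ → ℕ} {N : ℕ} {x : ℕ → ℕ → ℕ}

theorem mono_le (h : IsGT μ N x) (r : ℕ) : Monotone fun i => x i r :=
  monotone_nat_of_le_succ fun i => h.mono i r

theorem le_top (h : IsGT μ N x) (i r : ℕ) : x i r ≤ μ r := by
  have := h.mono_le r (le_max_left i N)
  simpa [h.top (max i N) r (le_max_right _ _)] using this

theorem antitone (h : IsGT μ N x) (i : ℕ) : Antitone (x i) :=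
  antitone_nat_of_succ_le fun r => (h.mono i (r + 1)).trans (h.interlace i r)

theorem interlace_lt (h : IsGT μ N x) (i : ℕ) {r s : ℕ} (hrs : r < s) : x (i + 1) s ≤ x i r :=
  (h.antitone (i + 1) hrs).trans (h.interlace i r)

/-- Column strictness forces the entries of row `r` to be at least `r`. -/
theorem eq_zero_of_le (h : IsGT μ N x) : ∀ i r : ℕ, i ≤ r → x i r = 0
  | 0, r, _ => h.zero r
  | i + 1, r, hr => by
    obtain ⟨r, rfl⟩ : ∃ s, r = s + 1 := ⟨r - 1, by omega⟩
    exact Nat.le_zero.1 ((h.interlace i r).trans (h.eq_zero_of_le i r (by omega)).le)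

theorem top_antitone (h : IsGT μ N x) : Antitone μ := by
  have := h.antitone N
  intro r s hrs
  simpa [h.top N _ le_rfl] using this hrs

end IsGT

/-- A pattern is determined by its `N × N` corner: levels from `N` on equal `μ`, and entries with `i
≤ r` vanish. -/
theorem finite_setOf_isGT (μ : ℕ → ℕ) (N : ℕ) : {x | IsGT μ N x}.Finite := by
  refine Set.Finite.of_finite_image (f := fun x (i : Fin N) (r : Fin N) => x i r) ?_ ?_
  · refine (Set.Finite.pi' fun i : Fin N => Set.Finite.pi' fun r : Fin N =>
      Set.finite_Iic (μ r)).subset ?_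
    rintro _ ⟨x, hx, rfl⟩ i r
    exact hx.le_top i r
  · intro x hx y hy hxy
    funext i r
    by_cases hi : N ≤ i
    · rw [hx.top i r hi, hy.top i r hi]
    by_cases hr : i ≤ r
    · rw [hx.eq_zero_of_le i r hr, hy.eq_zero_of_le i r hr]
    · exact congrFun (congrFun hxy ⟨i, by omega⟩) ⟨r, by omega⟩

/-- The finite set of Gelfand–Tsetlin patterns. -/
def gtPatterns (μ : ℕ → ℕ) (N : ℕ) : Finset (ℕ → ℕ → ℕ) := (finite_setOf_isGT μ N).toFinset

theorem mem_gtPatterns {μ : ℕ → ℕ} {N : ℕ} {x : ℕ → ℕ → ℕ} :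
    x ∈ gtPatterns μ N ↔ IsGT μ N x := by
  simp [gtPatterns]

/-- The number of cells with entry `< i` in the columns `≥ J` of the first `L` rows. -/
def gtSize (L J : ℕ) (x : ℕ → ℕ → ℕ) (i : ℕ) : ℕ := ∑ r ∈ Finset.range L, (x i r - J)

/-- The number of entries `i` in the columns `≥ J` of the first `L` rows. -/
def gtWeight (L J : ℕ) (x : ℕ → ℕ → ℕ) (i : ℕ) : ℕ := gtSize L J x (i + 1) - gtSize L J x i

theorem gtSize_mono {μ : ℕ → ℕ} {N L J : ℕ} {x : ℕ → ℕ → ℕ} (h : IsGT μ N x) :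
    Monotone (gtSize L J x) :=
  monotone_nat_of_le_succ fun i => Finset.sum_le_sum fun r _ => Nat.sub_le_sub_right (h.mono i r) J

theorem gtWeight_add_gtSize {μ : ℕ → ℕ} {N L J : ℕ} {x : ℕ → ℕ → ℕ} (h : IsGT μ N x) (i : ℕ) :
    gtWeight L J x i + gtSize L J x i = gtSize L J x (i + 1) :=
  Nat.sub_add_cancel (gtSize_mono h (Nat.le_succ i))

theorem gtWeight_eq_sum {μ : ℕ → ℕ} {N L J : ℕ} {x : ℕ → ℕ → ℕ} (h : IsGT μ N x) (i : ℕ) :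
    gtWeight L J x i = ∑ r ∈ Finset.range L, ((x (i + 1) r - J) - (x i r - J)) :=
  (Finset.sum_tsub_distrib _ fun r _ => Nat.sub_le_sub_right (h.mono i r) J).symm

/-- The Bender–Knuth involution exchanging the letters `i` and `i + 1` in the
columns `< J` of a tableau, on the level of Gelfand–Tsetlin patterns. -/
def gtToggle (i J : ℕ) (x : ℕ → ℕ → ℕ) : ℕ → ℕ → ℕ := fun k r =>
  if k = i + 1 ∧ x (i + 1) r ≤ J then
    max (x i r) (x (i + 2) (r + 1)) +
      min (min (x (i + 2) r) (if r = 0 then J else x i (r - 1))) J - x (i + 1) r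
  else x k r

theorem gtToggle_of_ne {i J k : ℕ} (x : ℕ → ℕ → ℕ) (hk : k ≠ i + 1) :
    gtToggle i J x k = x k := by
  funext r; simp [gtToggle, hk]

theorem gtToggle_self (i J : ℕ) (x : ℕ → ℕ → ℕ) (r : ℕ) :
    gtToggle i J x (i + 1) r = if x (i + 1) r ≤ J then
    max (x i r) (x (i + 2) (r + 1)) +
      min (min (x (i + 2) r) (if r = 0 then J else x i (r - 1))) J - x (i + 1) r
    else x (i + 1) r := by
  simp [gtToggle]

section Toggle

variable {μ : ℕ → ℕ} {N L i J : ℕ} {x : ℕ → ℕ → ℕ}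

theorem IsGT.interlace_pred (h : IsGT μ N x) (i r : ℕ) (hr : r ≠ 0) :
    x (i + 1) r ≤ x i (r - 1) := by
  have := h.interlace i (r - 1)
  rwa [Nat.sub_add_cancel (Nat.one_le_iff_ne_zero.2 hr)] at this

/-- A toggled entry is reflected in the interval that its four neighbours allow, capped above at
`J`, and a reflection stays inside its interval. In row `0` one upper bound is absent; the
placeholder `J` is harmless because of the cap. -/
theorem IsGT.toggle_spec (h : IsGT μ N x) (r : ℕ) :
    x i r ≤ gtToggle i J x (i + 1) r ∧ gtToggle i J x (i + 1) r ≤ x (i + 2) r ∧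
      x (i + 2) (r + 1) ≤ gtToggle i J x (i + 1) r ∧
      (r ≠ 0 → gtToggle i J x (i + 1) r ≤ x i (r - 1)) := by
  have h1 := h.mono i r
  have h2 := h.mono (i + 1) r
  have h3 := h.interlace (i + 1) r
  have h4 := h.interlace_pred i r
  simp only [add_assoc, Nat.reduceAdd] at h2 h3
  rw [gtToggle_self]
  split_ifs with h5 h6 <;> omega

theorem IsGT.toggle (h : IsGT μ N x) (hi : i + 2 ≤ N) : IsGT μ N (gtToggle i J x) where
  zero r := by rw [gtToggle_of_ne _ (by omega), h.zero]
  mono k r := by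
    by_cases hk : k = i
    · subst hk
      rw [gtToggle_of_ne _ (show k ≠ k + 1 by omega)]
      exact (h.toggle_spec r).1
    by_cases hk' : k = i + 1
    · subst hk'
      rw [gtToggle_of_ne _ (show i + 1 + 1 ≠ i + 1 by omega)]
      exact (h.toggle_spec r).2.1
    · rw [gtToggle_of_ne _ hk', gtToggle_of_ne _ (by omega)]
      exact h.mono k r
  interlace k r := by
    by_cases hk : k = i
    · subst hk
      rw [gtToggle_of_ne _ (show k ≠ k + 1 by omega)]
      exact (h.toggle_spec (r + 1)).2.2.2 (by omega)
    by_cases hk' : k = i + 1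
    · subst hk'
      rw [gtToggle_of_ne _ (show i + 1 + 1 ≠ i + 1 by omega)]
      exact (h.toggle_spec r).2.2.1
    · rw [gtToggle_of_ne _ hk', gtToggle_of_ne _ (by omega)]
      exact h.interlace k r
  top k r hk := by rw [gtToggle_of_ne _ (by omega), h.top k r hk]

theorem IsGT.toggle_le_iff (h : IsGT μ N x) (r : ℕ) :
    gtToggle i J x (i + 1) r ≤ J ↔ x (i + 1) r ≤ J := by
  have h1 := h.mono i r
  have h3 := h.interlace (i + 1) r
  simp only [add_assoc, Nat.reduceAdd] at h3
  rw [gtToggle_self]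
  split_ifs with h5 h6 <;> omega

theorem IsGT.toggle_toggle (h : IsGT μ N x) : gtToggle i J (gtToggle i J x) = x := by
  funext k r
  by_cases hk : k = i + 1
  · subst hk
    have h1 := h.mono i r
    have h2 := h.mono (i + 1) r
    have h3 := h.interlace (i + 1) r
    have h4 := h.interlace_pred i r
    have h5 := h.toggle_le_iff (i := i) (J := J) r
    simp only [add_assoc, Nat.reduceAdd] at h2 h3
    rw [gtToggle_self, gtToggle_of_ne _ (show i ≠ i + 1 by omega),
      gtToggle_of_ne _ (show i + 2 ≠ i + 1 by omega)]
    rw [gtToggle_self] at *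
    split_ifs at * <;> omega
  · rw [gtToggle_of_ne _ hk, gtToggle_of_ne _ hk]

/-- Columns from `J` on are untouched, so every condition read off from them survives the toggle. -/
theorem IsGT.toggle_sub (h : IsGT μ N x) {J' : ℕ} (hJ : J ≤ J') (k r : ℕ) :
    gtToggle i J x k r - J' = x k r - J' := by
  by_cases hk : k = i + 1
  · subst hk
    have h5 := h.toggle_le_iff (i := i) (J := J) r
    rw [gtToggle_self] at *
    split_ifs at * <;> omega
  · rw [gtToggle_of_ne _ hk]

theorem IsGT.gtSize_toggle (h : IsGT μ N x) {J' : ℕ} (hJ : J ≤ J') :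
    gtSize L J' (gtToggle i J x) = gtSize L J' x := by
  funext k
  exact Finset.sum_congr rfl fun r _ => h.toggle_sub hJ k r

theorem IsGT.gtWeight_toggle (h : IsGT μ N x) {J' : ℕ} (hJ : J ≤ J') :
    gtWeight L J' (gtToggle i J x) = gtWeight L J' x := by
  funext k
  rw [gtWeight, gtWeight, h.gtSize_toggle hJ]

/-- The maximum in row `r` pairs with the minimum in row `r + 1`: both involve `κ r` and `θ (r +
1)`, and maximum plus minimum is the sum. -/
theorem sum_max_add_min (κ θ : ℕ → ℕ) (J : ℕ) (hθ : ∀ r, θ r ≤ J) (L : ℕ) :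
    ∑ r ∈ Finset.range L, (max (κ r) (θ (r + 1)) + min (θ r) (if r = 0 then J else κ (r - 1))) +
      min (θ L) (if L = 0 then J else κ (L - 1)) =
    ∑ r ∈ Finset.range L, (κ r + θ r) + θ L := by
  induction L with
  | zero => simpa using hθ 0
  | succ L ih =>
    rw [Finset.sum_range_succ, Finset.sum_range_succ]
    simp only [Nat.add_eq_zero_iff, one_ne_zero, and_false, if_false, Nat.add_sub_cancel]
    omega

/-- The number of cells with entry `< k` in the columns `< J` of the first `L` rows. -/
def gtMinSize (L J : ℕ) (x : ℕ → ℕ → ℕ) (k : ℕ) : ℕ := ∑ r ∈ Finset.range L, min (x k r) J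

theorem gtSize_add_gtMinSize (L J : ℕ) (x : ℕ → ℕ → ℕ) (k : ℕ) :
    gtSize L J x k + gtMinSize L J x k = gtSize L 0 x k := by
  rw [gtSize, gtMinSize, gtSize, ← Finset.sum_add_distrib]
  exact Finset.sum_congr rfl fun r _ => by omega

/-- Old plus new entry is the sum of the endpoints of the reflection interval, and `sum_max_add_min`
adds these up. The hypothesis `hJ` says that column `J` contains no letter `i`; a row that is not
toggled then has only letters below `i` in the columns `< J`, so it contributes `J` to all four
sizes. -/
theorem IsGT.gtMinSize_toggle (h : IsGT μ N x) (hL : ∀ r, L ≤ r → μ r = 0)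
    (hJ : ∀ r, x i r ≤ J → x (i + 1) r ≤ J) :
    gtMinSize L J (gtToggle i J x) (i + 1) + gtMinSize L J x (i + 1) =
      gtMinSize L J x i + gtMinSize L J x (i + 2) := by
  have key := sum_max_add_min (fun r => min (x i r) J) (fun r => min (x (i + 2) r) J) J
    (fun r => min_le_right _ _) L
  have h0 : x (i + 2) L = 0 := Nat.le_zero.1 ((h.le_top _ _).trans (hL L le_rfl).le)
  simp only [h0, Nat.zero_min, Nat.add_zero] at key
  rw [gtMinSize, gtMinSize, gtMinSize, gtMinSize, ← Finset.sum_add_distrib,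
    ← Finset.sum_add_distrib, ← key]
  refine Finset.sum_congr rfl fun r _ => ?_
  have h1 := h.mono i r
  have h2 := h.mono (i + 1) r
  have h3 := h.interlace (i + 1) r
  have h4 := h.interlace_pred i r
  have h5 := hJ r
  simp only [add_assoc, Nat.reduceAdd] at h2 h3
  rw [gtToggle_self]
  split_ifs <;> omega

/-- The toggle exchanges the multiplicities of `i` and `i + 1` in the columns `< J`. -/
theorem IsGT.gtWeight_toggle_zero (h : IsGT μ N x) (hi : i + 2 ≤ N) (hL : ∀ r, L ≤ r → μ r = 0)
    (hJ : ∀ r, x i r ≤ J → x (i + 1) r ≤ J) :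
    gtWeight L 0 (gtToggle i J x) i + gtWeight L J x (i + 1) =
        gtWeight L 0 x (i + 1) + gtWeight L J x i ∧
      gtWeight L 0 (gtToggle i J x) (i + 1) + gtWeight L J x i =
        gtWeight L 0 x i + gtWeight L J x (i + 1) ∧
      ∀ k, k ≠ i → k ≠ i + 1 → gtWeight L 0 (gtToggle i J x) k = gtWeight L 0 x k := by
  have hT := h.toggle (J := J) hi
  have e := h.gtMinSize_toggle hL hJ
  have ne : ∀ k, k ≠ i + 1 → gtSize L 0 (gtToggle i J x) k = gtSize L 0 x k := fun k hk => by
    rw [gtSize, gtSize, gtToggle_of_ne _ hk]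
  have s := gtSize_add_gtMinSize L J x
  have s' := gtSize_add_gtMinSize L J (gtToggle i J x) (i + 1)
  rw [h.gtSize_toggle le_rfl] at s'
  have s0 := s i
  have s1 := s (i + 1)
  have s2 := s (i + 2)
  have w0 := gtWeight_add_gtSize (L := L) (J := 0) h i
  have w1 := gtWeight_add_gtSize (L := L) (J := 0) h (i + 1)
  have w2 := gtWeight_add_gtSize (L := L) (J := J) h i
  have w3 := gtWeight_add_gtSize (L := L) (J := J) h (i + 1)
  have w4 := gtWeight_add_gtSize (L := L) (J := 0) hT i
  have w5 := gtWeight_add_gtSize (L := L) (J := 0) hT (i + 1)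
  rw [ne i (by omega)] at w4
  rw [ne (i + 1 + 1) (by omega)] at w5
  simp only [add_assoc, Nat.reduceAdd] at *
  refine ⟨by omega, by omega, fun k h1 h2 => ?_⟩
  rw [gtWeight, gtWeight, ne k (by omega), ne (k + 1) (by omega)]

end Toggle

/-! ### Alternants and the product of a Schur polynomial with an alternant -/

section Column

variable {μ : ℕ → ℕ} {N L i J : ℕ} {x : ℕ → ℕ → ℕ}

theorem IsGT.gtWeight_eq_add_card (h : IsGT μ N x) (i J : ℕ) :
    gtWeight L J x i = gtWeight L (J + 1) x i +
      ((Finset.range L).filter fun r => x i r ≤ J ∧ J < x (i + 1) r).card := by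
  rw [gtWeight_eq_sum h, gtWeight_eq_sum h, Finset.card_filter, ← Finset.sum_add_distrib]
  refine Finset.sum_congr rfl fun r _ => ?_
  have := h.mono i r
  split_ifs <;> omega

/-- Column strictness: the set consists of the rows in which column `J` has the entry `i`. -/
theorem IsGT.card_column_le_one (h : IsGT μ N x) (i J : ℕ) :
    ((Finset.range L).filter fun r => x i r ≤ J ∧ J < x (i + 1) r).card ≤ 1 := by
  refine Finset.card_le_one.2 fun r hr s hs => ?_
  simp only [Finset.mem_filter] at hr hs
  by_contra hne
  rcases lt_or_gt_of_ne hne with hlt | hlt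
  · have := h.interlace_lt i hlt
    omega
  · have := h.interlace_lt i hlt
    omega

theorem IsGT.not_mem_column (h : IsGT μ N x) (hL : ∀ r, L ≤ r → μ r = 0)
    (hw : gtWeight L J x i = gtWeight L (J + 1) x i) (r : ℕ) (hr : x i r ≤ J) :
    x (i + 1) r ≤ J := by
  rw [h.gtWeight_eq_add_card, Nat.add_eq_left, Finset.card_eq_zero, Finset.filter_eq_empty_iff]
    at hw
  by_cases hrL : r < L
  · have := hw (Finset.mem_range.2 hrL)
    omega
  · have := h.le_top (i + 1) r
    rw [hL r (by omega)] at this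
    omega

end Column

section Alternant

variable {R : Type*} [CommRing R] {N : ℕ}

/-- The alternant `det (y_p ^ β_q)`. -/
def alternant (y : Fin N → R) (β : ℕ → ℕ) : R :=
  Matrix.det (Matrix.of fun p q : Fin N => y p ^ β q)

/-- The Schur polynomial of shape `μ`, as a sum over Gelfand–Tsetlin patterns. -/
def gtSchur (L : ℕ) (μ : ℕ → ℕ) (y : Fin N → R) : R :=
  ∑ x ∈ gtPatterns μ N, ∏ k : Fin N, y k ^ gtWeight L 0 x k

theorem alternant_swap (y : Fin N → R) (β β' : ℕ → ℕ) (p q : Fin N) (hpq : p ≠ q)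
    (hp : β' p = β q) (hq : β' q = β p) (h : ∀ k : Fin N, k ≠ p → k ≠ q → β' k = β k) :
    alternant y β' = -alternant y β := by
  have e : (Matrix.of fun a b : Fin N => y a ^ β' b) =
      (Matrix.of fun a b : Fin N => y a ^ β b).submatrix id (Equiv.swap p q) := by
    ext a b
    simp only [Matrix.of_apply, Matrix.submatrix_apply, id]
    congr 1
    by_cases h1 : b = p
    · subst h1; rw [Equiv.swap_apply_left, hp]
    by_cases h2 : b = q
    · subst h2; rw [Equiv.swap_apply_right, hq]
    · rw [Equiv.swap_apply_of_ne_of_ne h1 h2, h b h1 h2]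
  rw [alternant, alternant, e, Matrix.det_permute', Equiv.Perm.sign_swap hpq]
  simp

/-- Taking `J = μ 0` toggles all columns; this is the classical Bender–Knuth involution, which
exchanges the multiplicities of `i` and `i + 1`. -/
theorem gtSchur_swap {L : ℕ} {μ : ℕ → ℕ} (hL : ∀ r, L ≤ r → μ r = 0) (y : Fin (N + 1) → R)
    (i : Fin N) :
    gtSchur L μ (y ∘ Equiv.swap i.castSucc i.succ) = gtSchur L μ y := by
  have hlt : ∀ {x}, IsGT μ (N + 1) x → ∀ k r, x k r ≤ μ 0 := fun h k r =>
    (h.le_top k r).trans (h.top_antitone (Nat.zero_le r))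
  have hz : ∀ {x}, IsGT μ (N + 1) x → ∀ k, gtWeight L (μ 0) x k = 0 := fun h k => by
    rw [gtWeight_eq_sum h]
    exact Finset.sum_eq_zero fun r _ => by
      have := hlt h (k + 1) r
      omega
  have hiN : (i : ℕ) + 2 ≤ N + 1 := by omega
  refine Finset.sum_bij' (fun x _ => gtToggle i (μ 0) x) (fun x _ => gtToggle i (μ 0) x)
    ?_ ?_ ?_ ?_ ?_
  · intro x hx
    rw [mem_gtPatterns] at *
    exact hx.toggle hiN
  · intro x hx
    rw [mem_gtPatterns] at *
    exact hx.toggle hiN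
  · intro x hx
    exact (mem_gtPatterns.1 hx).toggle_toggle
  · intro x hx
    exact (mem_gtPatterns.1 hx).toggle_toggle
  · intro x hx
    have h := mem_gtPatterns.1 hx
    obtain ⟨h1, h2, h3⟩ := h.gtWeight_toggle_zero (J := μ 0) hiN hL fun r _ => hlt h _ _
    rw [hz h, hz h] at h1 h2
    rw [← Equiv.prod_comp (Equiv.swap i.castSucc i.succ)]
    refine Finset.prod_congr rfl fun k _ => ?_
    simp only [Function.comp, Equiv.swap_apply_self]
    congr 1
    by_cases hk : k = i.castSucc
    · subst hk
      rw [Equiv.swap_apply_left]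
      simpa using h1.symm
    by_cases hk' : k = i.succ
    · subst hk'
      rw [Equiv.swap_apply_right]
      simpa using h2.symm
    · rw [Equiv.swap_apply_of_ne_of_ne hk hk', h3]
      · exact fun h => hk (Fin.ext h)
      · exact fun h => hk' (Fin.ext h)

theorem gtSchur_perm {L : ℕ} {μ : ℕ → ℕ} (hL : ∀ r, L ≤ r → μ r = 0) (y : Fin N → R)
    (w : Equiv.Perm (Fin N)) : gtSchur L μ (y ∘ w) = gtSchur L μ y := by
  cases N with
  | zero => congr 1; exact Subsingleton.elim _ _
  | succ N =>
    have hw : w ∈ Submonoid.closure (Set.range fun i : Fin N => Equiv.swap i.castSucc i.succ) := by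
      rw [Equiv.Perm.mclosure_swap_castSucc_succ]; trivial
    induction hw using Submonoid.closure_induction generalizing y with
    | mem w hw =>
      obtain ⟨i, rfl⟩ := hw
      exact gtSchur_swap hL y i
    | one => rfl
    | mul a b _ _ ha hb =>
      rw [Equiv.Perm.coe_mul, ← Function.comp_assoc, hb, ha]

theorem alternant_mul_gtSchur {L : ℕ} {μ : ℕ → ℕ} (hL : ∀ r, L ≤ r → μ r = 0) (y : Fin N → R)
    (β : ℕ → ℕ) :
    alternant y β * gtSchur L μ y =
      ∑ x ∈ gtPatterns μ N, alternant y fun k => β k + gtWeight L 0 x k := by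
  simp only [alternant, Matrix.det_apply', Finset.sum_mul]
  rw [Finset.sum_comm]
  refine Finset.sum_congr rfl fun w _ => ?_
  -- Symmetry allows the variables to be permuted by `w` in the `w`-term of the determinant, so that
  -- the exponents add factor by factor.
  rw [← gtSchur_perm hL y w, gtSchur, Finset.mul_sum]
  refine Finset.sum_congr rfl fun x _ => ?_
  simp only [Matrix.of_apply, Function.comp, pow_add, Finset.prod_mul_distrib]
  ring

/-- `λ` plus the content of the columns `≥ J` is (weakly) decreasing. -/
def GoodFrom (l : ℕ → ℕ) (N L J : ℕ) (x : ℕ → ℕ → ℕ) : Prop :=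
  ∀ i, i + 1 < N → l (i + 1) + gtWeight L J x (i + 1) ≤ l i + gtWeight L J x i

/-- The first place where `GoodFrom` fails. -/
def badIndex (l : ℕ → ℕ) (N L J : ℕ) (x : ℕ → ℕ → ℕ) : ℕ :=
  sInf {i | i + 1 < N ∧ l i + gtWeight L J x i < l (i + 1) + gtWeight L J x (i + 1)}

theorem badIndex_spec {l : ℕ → ℕ} {L J : ℕ} {x : ℕ → ℕ → ℕ} (h : ¬GoodFrom l N L J x) :
    badIndex l N L J x + 1 < N ∧
      l (badIndex l N L J x) + gtWeight L J x (badIndex l N L J x) <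
        l (badIndex l N L J x + 1) + gtWeight L J x (badIndex l N L J x + 1) := by
  refine Nat.sInf_mem (s := {i | i + 1 < N ∧
    l i + gtWeight L J x i < l (i + 1) + gtWeight L J x (i + 1)}) ?_
  simp only [GoodFrom, not_forall, not_le] at h
  obtain ⟨i, hi, h⟩ := h
  exact ⟨i, hi, h⟩

theorem goodFrom_congr {l : ℕ → ℕ} {L J : ℕ} {x x' : ℕ → ℕ → ℕ}
    (h : gtWeight L J x = gtWeight L J x') : GoodFrom l N L J x ↔ GoodFrom l N L J x' := by
  rw [GoodFrom, GoodFrom, h]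

-- A sign-reversing involution. Here `J` is the largest threshold at which the partition condition
-- fails, and the toggle acts on the first failing index in the columns `< J`. The columns `≥ J` do
-- not change, so neither do `J` and the index. Fixed points contribute zero because their alternant
-- equals its own negative.
open Classical in
theorem sum_alternant_bad {L J : ℕ} {l μ : ℕ → ℕ} [NoZeroDivisors R] [CharZero R]
    (hL : ∀ r, L ≤ r → μ r = 0) (y : Fin N → R) :
    ∑ x ∈ gtPatterns μ N with (∀ J', J < J' → GoodFrom l N L J' x) ∧ ¬GoodFrom l N L J x,
      alternant y (fun k => l k + (N - 1 - k) + gtWeight L 0 x k) = 0 := by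
  have key : ∀ x, IsGT μ N x → (∀ J', J < J' → GoodFrom l N L J' x) → ¬GoodFrom l N L J x →
      alternant y (fun k => l k + (N - 1 - k) +
          gtWeight L 0 (gtToggle (badIndex l N L J x) J x) k) =
        -alternant y (fun k => l k + (N - 1 - k) + gtWeight L 0 x k) := by
    intro x h hg hb
    obtain ⟨hi, hlt⟩ := badIndex_spec hb
    set i := badIndex l N L J x
    -- Good at `J + 1`, bad at `J`, and at most one `i + 1` in column `J`: hence column `J` contains
    -- `i + 1` but not `i`, and the inequality fails by exactly one. This one is the staircase
    -- difference, so the toggle interchanges the exponents at `i` and `i + 1`.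
    have g := hg (J + 1) (Nat.lt_succ_self J) i hi
    have a1 := h.gtWeight_eq_add_card (L := L) i J
    have a2 := h.gtWeight_eq_add_card (L := L) (i + 1) J
    have c2 := h.card_column_le_one (L := L) (i + 1) J
    obtain ⟨h1, h2, h3⟩ := h.gtWeight_toggle_zero (J := J) (show i + 2 ≤ N by omega) hL
      (h.not_mem_column hL (by omega))
    refine alternant_swap y _ _ ⟨i, by omega⟩ ⟨i + 1, hi⟩ (by simp) ?_ ?_ ?_
    · simp only; omega
    · simp only; omega
    · intro k hk1 hk2
      rw [h3 k (fun h => hk1 (Fin.ext h)) (fun h => hk2 (Fin.ext h))]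
  refine Finset.sum_involution (fun x _ => gtToggle (badIndex l N L J x) J x) ?_ ?_ ?_ ?_
  · intro x hx
    simp only [Finset.mem_filter, mem_gtPatterns] at hx
    rw [key x hx.1 hx.2.1 hx.2.2, add_neg_cancel]
  · intro x hx hne heq
    simp only [Finset.mem_filter, mem_gtPatterns] at hx
    have := key x hx.1 hx.2.1 hx.2.2
    rw [heq] at this
    exact hne (self_eq_neg.1 this)
  · intro x hx
    simp only [Finset.mem_filter, mem_gtPatterns] at hx ⊢
    obtain ⟨h, hg, hb⟩ := hx
    refine ⟨h.toggle (by have := (badIndex_spec hb).1; omega), fun J' hJ => ?_, ?_⟩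
    · rw [goodFrom_congr (h.gtWeight_toggle hJ.le)]
      exact hg J' hJ
    · rwa [goodFrom_congr (h.gtWeight_toggle le_rfl)]
  · intro x hx
    simp only [Finset.mem_filter, mem_gtPatterns] at hx
    have : badIndex l N L J (gtToggle (badIndex l N L J x) J x) = badIndex l N L J x := by
      rw [badIndex, hx.1.gtWeight_toggle le_rfl, ← badIndex]
    simp only [this]
    exact hx.1.toggle_toggle

open Classical in
/-- The patterns such that `λ` plus the content of the columns `≥ J` is a partition for all `J`. -/
def lrPatterns (l μ : ℕ → ℕ) (N L : ℕ) : Finset (ℕ → ℕ → ℕ) :=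
  {x ∈ gtPatterns μ N | ∀ J, GoodFrom l N L J x}

theorem mem_lrPatterns {l μ : ℕ → ℕ} {L : ℕ} {x : ℕ → ℕ → ℕ} :
    x ∈ lrPatterns l μ N L ↔ IsGT μ N x ∧ ∀ J, GoodFrom l N L J x := by
  simp [lrPatterns, mem_gtPatterns]

theorem IsGT.gtWeight_eq_zero_of_le {μ : ℕ → ℕ} {L J : ℕ} {x : ℕ → ℕ → ℕ} (h : IsGT μ N x)
    (hJ : μ 0 ≤ J) (k : ℕ) : gtWeight L J x k = 0 := by
  rw [gtWeight_eq_sum h]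
  exact Finset.sum_eq_zero fun r _ => by
    have := (h.le_top (k + 1) r).trans (h.top_antitone (Nat.zero_le r))
    omega

open Classical in
/-- Only Littlewood–Richardson patterns contribute to the product of an alternant
and a Schur polynomial. -/
theorem alternant_mul_gtSchur_eq_sum_lr [NoZeroDivisors R] [CharZero R] {L : ℕ} {l μ : ℕ → ℕ}
    (hl : Antitone l) (hL : ∀ r, L ≤ r → μ r = 0) (y : Fin N → R) :
    alternant y (fun k => l k + (N - 1 - k)) * gtSchur L μ y =
      ∑ x ∈ lrPatterns l μ N L, alternant y fun k => l k + (N - 1 - k) + gtWeight L 0 x k := by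
  rw [alternant_mul_gtSchur hL]
  -- The threshold descends from `μ 0`, beyond which all columns are empty. Each step discards the
  -- patterns whose largest bad threshold is the next one, and these cancel.
  have step : ∀ J ≤ μ 0, ∑ x ∈ gtPatterns μ N with ∀ J', μ 0 - J ≤ J' → GoodFrom l N L J' x,
      alternant y (fun k => l k + (N - 1 - k) + gtWeight L 0 x k) =
      ∑ x ∈ gtPatterns μ N, alternant y (fun k => l k + (N - 1 - k) + gtWeight L 0 x k) := by
    intro J
    induction J with
    | zero =>
      intro _
      rw [Finset.filter_true_of_mem]
      intro x hx J' hJ' i _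
      have h := mem_gtPatterns.1 hx
      rw [h.gtWeight_eq_zero_of_le (by omega), h.gtWeight_eq_zero_of_le (by omega)]
      simpa using hl (Nat.le_succ i)
    | succ J ih =>
      intro hJ
      rw [← ih (by omega), eq_comm, ← Finset.sum_filter_add_sum_filter_not
        (Finset.filter _ _) (fun x => GoodFrom l N L (μ 0 - (J + 1)) x)]
      rw [Finset.filter_filter, Finset.filter_filter]
      have hb := sum_alternant_bad (l := l) (J := μ 0 - (J + 1)) hL y
      have hs : ∀ x, (∀ J', μ 0 - J ≤ J' → GoodFrom l N L J' x) ↔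
          ∀ J', μ 0 - (J + 1) < J' → GoodFrom l N L J' x := fun x =>
        forall_congr' fun J' => by rw [show μ 0 - J ≤ J' ↔ μ 0 - (J + 1) < J' by omega]
      simp only [hs]
      rw [hb, add_zero]
      refine Finset.sum_congr (Finset.filter_congr fun x _ => ⟨fun h J' hJ' => ?_,
        fun h => ⟨fun J' hJ' => h J' hJ'.le, h _ le_rfl⟩⟩) fun _ _ => rfl
      rcases hJ'.eq_or_lt with rfl | hlt
      · exact h.2
      · exact h.1 J' hlt
  have := step (μ 0) le_rfl
  simp only [Nat.sub_self, Nat.zero_le, true_imp_iff] at this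
  exact this.symm

end Alternant

/-! ### The bialternant formula and the Littlewood–Richardson rule in finitely many variables. -/

section Bialternant

variable {μ : ℕ → ℕ} {N L : ℕ}

/-- For `λ = 0`, row `r` contains no letter `i > r`. Otherwise take the rightmost column where row
`r` has the letter `i`. From that column on, the letter `i - 1` must occur at least as often as `i`;
but the rows above lack it by induction, and in row `r` and below it lies strictly further left. -/
theorem IsGT.eq_of_good_zero {x : ℕ → ℕ → ℕ} (h : IsGT μ N x) (hL : ∀ r, L ≤ r → μ r = 0)
    (hg : ∀ J, GoodFrom (fun _ => 0) N L J x) (r : ℕ) :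
    ∀ i, r < i → x (i + 1) r = x i r := by
  induction r using Nat.strong_induction_on with
  | _ r ih =>
    intro i hri
    by_contra hne
    have hlt : x i r < x (i + 1) r := lt_of_le_of_ne (h.mono i r) (Ne.symm hne)
    have hiN : i < N := by
      by_contra hN
      rw [h.top i r (by omega), h.top (i + 1) r (by omega)] at hlt
      exact lt_irrefl _ hlt
    have hrL : r < L := by
      by_contra hrL
      have := h.le_top (i + 1) r
      rw [hL r (by omega)] at this
      omega
    obtain ⟨j, rfl⟩ : ∃ j, i = j + 1 := ⟨i - 1, by omega⟩
    have := hg (x (j + 1 + 1) r - 1) j hiN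
    rw [zero_add, zero_add, gtWeight_eq_sum h, gtWeight_eq_sum h] at this
    have hz : ∑ s ∈ Finset.range L, ((x (j + 1) s - (x (j + 1 + 1) r - 1)) -
        (x j s - (x (j + 1 + 1) r - 1))) = 0 := by
      refine Finset.sum_eq_zero fun s _ => ?_
      rcases lt_trichotomy s r with hs | rfl | hs
      · rw [ih s hs j (by omega), Nat.sub_self]
      · omega
      · have h1 := h.antitone (j + 1) hs.le
        omega
    rw [hz] at this
    have h2 := (Finset.sum_eq_zero_iff.1 (Nat.le_zero.1 this)) r (Finset.mem_range.2 hrL)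
    omega

theorem lrPatterns_zero (hμ : Antitone μ) (hN : ∀ r, N ≤ r → μ r = 0)
    (hL : ∀ r, L ≤ r → μ r = 0) :
    lrPatterns (fun _ => 0) μ N L = {fun i r => if r < i then μ r else 0} := by
  have h0 : IsGT μ N (fun i r => if r < i then μ r else 0) :=
    { zero := fun r => by simp
      mono := fun i r => by split_ifs <;> omega
      interlace := fun i r => by
        have := hμ (Nat.le_succ r)
        split_ifs <;> omega
      top := fun i r hi => by
        split_ifs with h
        · rfl
        · rw [hN r (by omega)] }
  have hw : ∀ J i, gtWeight L J (fun i r => if r < i then μ r else 0) i = μ i - J := by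
    intro J i
    rw [gtWeight_eq_sum h0]
    rw [Finset.sum_eq_single i]
    · simp
    · intro r _ hr
      have : r < i + 1 ↔ r < i := by omega
      simp [this]
    · intro hi
      simp [hL i (by simpa using hi)]
  ext x
  rw [mem_lrPatterns, Finset.mem_singleton]
  constructor
  · rintro ⟨h, hg⟩
    funext i r
    split_ifs with hr
    · have hc : ∀ k, x (i + k) r = x i r := by
        intro k
        induction k with
        | zero => rfl
        | succ k ih => rw [← ih]; exact h.eq_of_good_zero hL hg r (i + k) (by omega)
      rw [← hc N, h.top _ _ (by omega)]
    · exact h.eq_zero_of_le i r (by omega)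
  · rintro rfl
    refine ⟨h0, fun J i _ => ?_⟩
    rw [hw, hw]
    have := hμ (Nat.le_succ i)
    simp only [Nat.succ_eq_add_one] at this ⊢
    omega

theorem gtWeight_highest (hL : ∀ r, L ≤ r → μ r = 0) (i : ℕ) :
    gtWeight L 0 (fun i r => if r < i then μ r else 0) i = μ i := by
  have : ∀ r, (if r < i + 1 then μ r else 0) = (if r < i then μ r else 0) +
      if r = i then μ i else 0 := by
    intro r
    rcases lt_trichotomy r i with h | rfl | h
    · simp [h, h.ne, h.trans (Nat.lt_succ_self i)]
    · simp
    · simp [h.ne', not_lt.2 h.le, Nat.not_le.2 h]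
  simp only [gtWeight, gtSize, Nat.sub_zero, this, Finset.sum_add_distrib, Nat.add_sub_cancel_left,
    Finset.sum_ite_eq', Finset.mem_range, ite_eq_left_iff, not_lt]
  exact fun h => (hL i h).symm

variable {R : Type*} [CommRing R] [NoZeroDivisors R] [CharZero R]

/-- This is the case `λ = 0` of `alternant_mul_gtSchur_eq_sum_lr`: the only surviving tableau has
all entries of row `r` equal to `r`, and its content is `μ`. -/
theorem alternant_mul_gtSchur_eq_alternant (hμ : Antitone μ) (hN : ∀ r, N ≤ r → μ r = 0)
    (hL : ∀ r, L ≤ r → μ r = 0) (y : Fin N → R) :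
    alternant y (fun k => N - 1 - k) * gtSchur L μ y = alternant y fun k => μ k + (N - 1 - k) := by
  have := alternant_mul_gtSchur_eq_sum_lr (l := fun _ => 0) antitone_const hL y
  rw [lrPatterns_zero hμ hN hL, Finset.sum_singleton] at this
  simp only [zero_add, gtWeight_highest hL] at this
  rw [this]
  congr 1
  funext k
  exact add_comm _ _

/-- Reversing the columns gives the Vandermonde determinant. -/
theorem alternant_staircase_ne_zero [Nontrivial R] (y : Fin N → R) (hy : Function.Injective y) :
    alternant y (fun k => N - 1 - k) ≠ 0 := by
  have : IsDomain R := { }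
  have e : (Matrix.of fun p q : Fin N => y p ^ (N - 1 - (q : ℕ))) =
      (Matrix.vandermonde y).submatrix id Fin.revPerm := by
    ext p q
    simp only [Matrix.of_apply, Matrix.submatrix_apply, id, Matrix.vandermonde_apply,
      Fin.revPerm_apply, Fin.val_rev]
    congr 1
    omega
  rw [alternant, e, Matrix.det_permute']
  refine mul_ne_zero ?_ (Matrix.det_vandermonde_ne_zero_iff.2 hy)
  rcases Int.units_eq_one_or (Equiv.Perm.sign (Fin.revPerm : Equiv.Perm (Fin N))) with h | h <;>
    simp [h]

/-- The Littlewood–Richardson rule for Schur polynomials. -/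
theorem gtSchur_mul_gtSchur [Nontrivial R] {l : ℕ → ℕ} (hl : Antitone l)
    (hlN : ∀ r, N ≤ r → l r = 0) (hL : ∀ r, L ≤ r → μ r = 0) {M : ℕ} (hNM : N ≤ M)
    (hlM : ∀ r, M ≤ r → l r = 0) (y : Fin N → R) (hy : Function.Injective y)
    (hgood : ∀ x ∈ lrPatterns l μ N L, Antitone (fun k => l k + gtWeight L 0 x k) ∧
      ∀ k, N ≤ k → gtWeight L 0 x k = 0) :
    gtSchur M l y * gtSchur L μ y =
      ∑ x ∈ lrPatterns l μ N L, gtSchur M (fun k => l k + gtWeight L 0 x k) y := by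
  apply mul_left_cancel₀ (alternant_staircase_ne_zero y hy)
  rw [← mul_assoc, alternant_mul_gtSchur_eq_alternant hl hlN hlM,
    alternant_mul_gtSchur_eq_sum_lr hl hL, Finset.mul_sum]
  refine Finset.sum_congr rfl fun x hx => ?_
  obtain ⟨h1, h2⟩ := hgood x hx
  rw [alternant_mul_gtSchur_eq_alternant h1 (fun r hr => by rw [hlN r hr, h2 r hr])
    (fun r hr => by rw [hlM r hr, h2 r (by omega)])]
  congr 1
  funext k
  omega

end Bialternant

/-! ### Truncation to finitely many variables -/

/-- The ring homomorphism setting the variables `x_i`, `i ≥ N`, to zero. -/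
def truncVars (N : ℕ) : MvPowerSeries ℕ ℂ →+* MvPowerSeries ℕ ℂ :=
  MvPowerSeries.rescale fun i => if i < N then 1 else 0

theorem coeff_truncVars (N : ℕ) (f : MvPowerSeries ℕ ℂ) (d : ℕ →₀ ℕ) :
    MvPowerSeries.coeff d (truncVars N f) =
      open Classical in if ∀ k, N ≤ k → d k = 0 then MvPowerSeries.coeff d f else 0 := by
  rw [truncVars, MvPowerSeries.coeff_rescale]
  split_ifs with h
  · rw [Finsupp.prod, Finset.prod_eq_one, one_mul]
    intro k hk
    rw [if_pos, one_pow]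
    by_contra hN
    exact (Finsupp.mem_support_iff.1 hk) (h k (not_lt.1 hN))
  · push Not at h
    obtain ⟨k, hk, hd⟩ := h
    rw [Finsupp.prod, Finset.prod_eq_zero (Finsupp.mem_support_iff.2 hd), zero_mul]
    rw [if_neg (not_lt.2 hk), zero_pow hd]

/-- Each exponent involves finitely many variables, so its coefficient is visible in every
sufficiently large truncation. -/
theorem eq_of_truncVars_eq {f g : MvPowerSeries ℕ ℂ} (N₀ : ℕ)
    (h : ∀ N, N₀ ≤ N → truncVars N f = truncVars N g) : f = g := by
  ext d
  have := congrArg (MvPowerSeries.coeff d) (h (max N₀ (d.support.sup id + 1)) (le_max_left _ _))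
  rw [coeff_truncVars, coeff_truncVars, if_pos, if_pos] at this
  · exact this
  all_goals
    intro k hk
    by_contra hd
    have := Finset.le_sup (f := id) (Finsupp.mem_support_iff.2 hd)
    have := (le_max_right _ _).trans hk
    simp only [id] at *
    omega

theorem truncVars_eq_sum {ι : Type*} (N : ℕ) (s : Finset ι) (v : ι → ℕ →₀ ℕ)
    (hv : ∀ i ∈ s, ∀ k, N ≤ k → v i k = 0) (f : MvPowerSeries ℕ ℂ)
    (hf : ∀ d : ℕ →₀ ℕ, (∀ k, N ≤ k → d k = 0) → f d = (s.filter fun i => v i = d).card) :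
    truncVars N f = ∑ i ∈ s, MvPowerSeries.monomial (v i) 1 := by
  classical
  ext d
  rw [coeff_truncVars, map_sum]
  simp only [MvPowerSeries.coeff_monomial]
  split_ifs with h
  · rw [MvPowerSeries.coeff_apply, hf d h, Finset.card_filter]
    push_cast
    exact Finset.sum_congr rfl fun i _ => by simp only [eq_comm]
  · refine (Finset.sum_eq_zero fun i hi => if_neg ?_).symm
    rintro rfl
    exact h (hv i hi)

theorem monomial_eq_prod_X {ι : Type*} (s : Finset ι) (p : ι → ℕ) (w : ι → ℕ) :
    MvPowerSeries.monomial (∑ k ∈ s, Finsupp.single (p k) (w k)) (1 : ℂ) =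
      ∏ k ∈ s, (MvPowerSeries.X (p k) : MvPowerSeries ℕ ℂ) ^ w k := by
  simp only [MvPowerSeries.X_pow_eq]
  rw [MvPowerSeries.prod_monomial]
  simp

/-! ### Schur functions as sums over Gelfand–Tsetlin patterns -/

/-- Turns the cardinalities defining `gtOfTableau` and `tableauEntry` into equivalences of strict
inequalities, from which the two constructions are seen to be mutually inverse. -/
theorem mem_iff_lt_card_of_isLowerSet (S : Finset ℕ) (h : ∀ a ∈ S, ∀ b < a, b ∈ S) (c : ℕ) :
    c ∈ S ↔ c < S.card := by
  constructor
  · intro hc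
    have : Finset.range (c + 1) ⊆ S := fun b hb => by
      rcases Nat.lt_succ_iff_lt_or_eq.1 (Finset.mem_range.1 hb) with hb | rfl
      · exact h c hc b hb
      · exact hc
    simpa using Finset.card_le_card this
  · intro hc
    by_contra hcS
    have : S ⊆ Finset.range c := fun a ha => by
      rw [Finset.mem_range]
      by_contra hac
      rcases (not_lt.1 hac).eq_or_lt with rfl | hlt
      · exact hcS ha
      · exact hcS (h a ha c hlt)
    have := Finset.card_le_card this
    rw [Finset.card_range] at this
    omega

/-- The pattern of a tableau. -/
def gtOfTableau {μ : YoungDiagram} (T : SemistandardYoungTableau μ) (i r : ℕ) : ℕ :=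
  ((Finset.range (μ.rowLen r)).filter fun c => T r c < i).card

theorem lt_gtOfTableau {μ : YoungDiagram} (T : SemistandardYoungTableau μ) (i r c : ℕ) :
    c < gtOfTableau T i r ↔ c < μ.rowLen r ∧ T r c < i := by
  rw [gtOfTableau, ← mem_iff_lt_card_of_isLowerSet, Finset.mem_filter, Finset.mem_range]
  intro a ha b hb
  rw [Finset.mem_filter, Finset.mem_range] at *
  exact ⟨hb.trans ha.1, (T.row_weak hb (YoungDiagram.mem_iff_lt_rowLen.2 ha.1)).trans_lt ha.2⟩

theorem isGT_gtOfTableau {μ : YoungDiagram} (T : SemistandardYoungTableau μ) {N : ℕ}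
    (hN : ∀ r c, (r, c) ∈ μ → T r c < N) : IsGT μ.rowLen N (gtOfTableau T) where
  zero r := by simp [gtOfTableau]
  mono i r := le_of_forall_lt fun c hc => by
    rw [lt_gtOfTableau] at *
    exact ⟨hc.1, hc.2.trans (Nat.lt_succ_self i)⟩
  interlace i r := le_of_forall_lt fun c hc => by
    rw [lt_gtOfTableau] at *
    refine ⟨hc.1.trans_le (μ.rowLen_anti _ _ (Nat.le_succ r)), ?_⟩
    have := T.col_strict (Nat.lt_succ_self r) (YoungDiagram.mem_iff_lt_rowLen.2 hc.1)
    simp only [Nat.succ_eq_add_one] at this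
    omega
  top i r hi := by
    refine eq_of_forall_lt_iff fun c => ?_
    rw [lt_gtOfTableau, and_iff_left_iff_imp]
    exact fun hc => (hN r c (YoungDiagram.mem_iff_lt_rowLen.2 hc)).trans_le hi

/-- The entry in row `r` and column `c` of the tableau of a pattern. -/
def tableauEntry (μ : YoungDiagram) (N : ℕ) (x : ℕ → ℕ → ℕ) (r c : ℕ) : ℕ :=
  if c < μ.rowLen r then ((Finset.range N).filter fun k => x (k + 1) r ≤ c).card else 0

theorem tableauEntry_lt {μ : YoungDiagram} {N : ℕ} {x : ℕ → ℕ → ℕ} (h : IsGT μ.rowLen N x)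
    {r c : ℕ} (hc : c < μ.rowLen r) (i : ℕ) : tableauEntry μ N x r c < i ↔ c < x i r := by
  rw [tableauEntry, if_pos hc]
  cases i with
  | zero => simp [h.zero r]
  | succ k =>
    rw [Nat.lt_succ_iff, ← not_lt, ← mem_iff_lt_card_of_isLowerSet, Finset.mem_filter,
      Finset.mem_range]
    · by_cases hk : k < N
      · simp [hk]
      · simp [hk, h.top (k + 1) r (by omega), hc]
    · intro a ha b hb
      rw [Finset.mem_filter, Finset.mem_range] at *
      exact ⟨hb.trans ha.1, (h.mono_le r (Nat.succ_le_succ hb.le)).trans ha.2⟩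

/-- The tableau of a pattern. -/
def tableauOfGT {μ : YoungDiagram} {N : ℕ} {x : ℕ → ℕ → ℕ} (h : IsGT μ.rowLen N x) :
    SemistandardYoungTableau μ where
  entry := tableauEntry μ N x
  row_weak' {i j1 j2} hj hm := by
    have hm' := YoungDiagram.mem_iff_lt_rowLen.1 hm
    rw [← Nat.lt_succ_iff, tableauEntry_lt h (hj.trans hm')]
    exact hj.trans ((tableauEntry_lt h hm' _).1 (Nat.lt_succ_self _))
  col_strict' {i1 i2 j} hi hm := by
    have hm' := YoungDiagram.mem_iff_lt_rowLen.1 hm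
    rw [tableauEntry_lt h (hm'.trans_le (μ.rowLen_anti _ _ hi.le))]
    exact ((tableauEntry_lt h hm' _).1 (Nat.lt_succ_self _)).trans_le (h.interlace_lt _ hi)
  zeros' {i j} hm := by
    rw [tableauEntry, if_neg (fun h => hm (YoungDiagram.mem_iff_lt_rowLen.2 h))]

theorem tableauOfGT_apply {μ : YoungDiagram} {N : ℕ} {x : ℕ → ℕ → ℕ} (h : IsGT μ.rowLen N x)
    (r c : ℕ) : tableauOfGT h r c = tableauEntry μ N x r c := rfl

theorem gtOfTableau_tableauOfGT {μ : YoungDiagram} {N : ℕ} {x : ℕ → ℕ → ℕ}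
    (h : IsGT μ.rowLen N x) : gtOfTableau (tableauOfGT h) = x := by
  funext i r
  refine eq_of_forall_lt_iff fun c => ?_
  rw [lt_gtOfTableau]
  constructor
  · rintro ⟨h1, h2⟩
    exact (tableauEntry_lt h h1 i).1 h2
  · intro hc
    have h1 := hc.trans_le (h.le_top i r)
    exact ⟨h1, (tableauEntry_lt h h1 i).2 hc⟩

theorem tableauOfGT_gtOfTableau {μ : YoungDiagram} (T : SemistandardYoungTableau μ) {N : ℕ}
    (h : IsGT μ.rowLen N (gtOfTableau T)) : tableauOfGT h = T := by
  ext r c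
  rw [tableauOfGT_apply]
  by_cases hc : c < μ.rowLen r
  · refine eq_of_forall_gt_iff fun i => ?_
    rw [tableauEntry_lt h hc, lt_gtOfTableau]
    exact and_iff_right hc
  · rw [tableauEntry, if_neg hc, T.zeros fun h => hc (YoungDiagram.mem_iff_lt_rowLen.1 h)]

theorem gtSize_gtOfTableau {μ : YoungDiagram} (T : SemistandardYoungTableau μ) {L : ℕ}
    (hL : ∀ r, L ≤ r → μ.rowLen r = 0) (k : ℕ) :
    gtSize L 0 (gtOfTableau T) k = (μ.cells.filter fun c => T c.1 c.2 < k).card := by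
  rw [gtSize, Finset.card_eq_sum_card_fiberwise (f := Prod.fst) (t := Finset.range L)]
  · refine Finset.sum_congr rfl fun r _ => ?_
    rw [Nat.sub_zero, gtOfTableau]
    refine Finset.card_bij (fun c _ => (r, c)) ?_ ?_ ?_
    · intro c hc
      simp only [Finset.mem_filter, Finset.mem_range, YoungDiagram.mem_cells,
        YoungDiagram.mem_iff_lt_rowLen] at *
      exact ⟨hc, trivial⟩
    · intro a _ b _ hab
      exact (Prod.ext_iff.1 hab).2
    · rintro ⟨a, c⟩ hc
      simp only [Finset.mem_filter, Finset.mem_range, YoungDiagram.mem_cells,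
        YoungDiagram.mem_iff_lt_rowLen] at *
      obtain ⟨hc, rfl⟩ := hc
      exact ⟨c, hc, rfl⟩
  · rintro ⟨a, c⟩ hc
    simp only [Finset.coe_filter, Set.mem_ofPred_eq, YoungDiagram.mem_cells,
        YoungDiagram.mem_iff_lt_rowLen, Finset.coe_range, Set.mem_Iio] at *
    by_contra ha
    have := hL a (not_lt.1 ha)
    omega

theorem sum_single_tableau {μ : YoungDiagram} (T : SemistandardYoungTableau μ) {L N : ℕ}
    (hL : ∀ r, L ≤ r → μ.rowLen r = 0) (hN : ∀ r c, (r, c) ∈ μ → T r c < N) :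
    ∑ c ∈ μ.cells, Finsupp.single (T c.1 c.2) 1 =
      ∑ k : Fin N, Finsupp.single (k : ℕ) (gtWeight L 0 (gtOfTableau T) k) := by
  classical
  ext k
  simp only [Finsupp.finsetSum_apply, Finsupp.single_apply]
  rw [← Finset.card_filter]
  by_cases hk : k < N
  · rw [Finset.sum_eq_single ⟨k, hk⟩]
    · rw [if_pos rfl, gtWeight, gtSize_gtOfTableau T hL, gtSize_gtOfTableau T hL,
        ← Finset.card_sdiff_of_subset]
      · congr 1
        ext c
        simp only [Finset.mem_filter, Finset.mem_sdiff]
        constructor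
        · rintro ⟨h1, h2⟩
          exact ⟨⟨h1, by omega⟩, by omega⟩
        · rintro ⟨⟨h1, h2⟩, h3⟩
          refine ⟨h1, ?_⟩
          by_contra hne
          exact h3 ⟨h1, by omega⟩
      · intro c
        simp only [Finset.mem_filter]
        exact fun h => ⟨h.1, by omega⟩
    · intro b _ hb
      exact if_neg fun h => hb (Fin.ext h)
    · simp
  · rw [Finset.sum_eq_zero, Finset.card_eq_zero, Finset.filter_eq_empty_iff]
    · rintro ⟨r, c⟩ hc
      have := hN r c hc
      simp only
      omega
    · intro b _
      exact if_neg (by omega)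

theorem lt_of_sum_single_eq {μ : YoungDiagram} {T : SemistandardYoungTableau μ} {N : ℕ}
    {d : ℕ →₀ ℕ} (hd : ∀ k, N ≤ k → d k = 0)
    (h : ∑ c ∈ μ.cells, Finsupp.single (T c.1 c.2) 1 = d) (r c : ℕ) (hrc : (r, c) ∈ μ) :
    T r c < N := by
  by_contra hN
  have h0 := hd (T r c) (not_lt.1 hN)
  rw [← h, Finsupp.finsetSum_apply] at h0
  have := Finset.sum_eq_zero_iff.1 h0 (r, c) hrc
  simp at this

/-- A monomial in the first `N` variables comes only from tableaux with entries `< N`, and these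
correspond bijectively to patterns of the same weight. -/
theorem truncVars_schur (μ : YoungDiagram) (N L : ℕ) (hL : ∀ r, L ≤ r → μ.rowLen r = 0) :
    truncVars N (schur μ) =
      gtSchur L μ.rowLen fun k : Fin N => (MvPowerSeries.X (k : ℕ) : MvPowerSeries ℕ ℂ) := by
  classical
  rw [truncVars_eq_sum N (gtPatterns μ.rowLen N)
    (fun x => ∑ k : Fin N, Finsupp.single (k : ℕ) (gtWeight L 0 x k)), gtSchur]
  · exact Finset.sum_congr rfl fun x _ => monomial_eq_prod_X _ _ _
  · intro x _ k hk
    rw [Finsupp.finsetSum_apply]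
    exact Finset.sum_eq_zero fun b _ => Finsupp.single_eq_of_ne (by omega)
  · intro d hd
    rw [schur, ← Nat.card_eq_finsetCard]
    congr 1
    refine Nat.card_congr
      { toFun := fun T => ⟨gtOfTableau T.1, ?_⟩
        invFun := fun x => ⟨tableauOfGT (mem_gtPatterns.1 (Finset.mem_filter.1 x.2).1), ?_⟩
        left_inv := fun T => Subtype.ext (tableauOfGT_gtOfTableau T.1
          (isGT_gtOfTableau T.1 (lt_of_sum_single_eq hd T.2)))
        right_inv := fun x => Subtype.ext
          (gtOfTableau_tableauOfGT (mem_gtPatterns.1 (Finset.mem_filter.1 x.2).1)) }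
    · have hN := lt_of_sum_single_eq hd T.2
      rw [Finset.mem_filter, mem_gtPatterns, ← sum_single_tableau T.1 hL hN]
      exact ⟨isGT_gtOfTableau T.1 hN, T.2⟩
    · obtain ⟨x, hx⟩ := x
      obtain ⟨hx1, hx2⟩ := Finset.mem_filter.1 hx
      rw [sum_single_tableau _ hL, gtOfTableau_tableauOfGT, hx2]
      intro r c hrc
      have hc := YoungDiagram.mem_iff_lt_rowLen.1 hrc
      rw [tableauOfGT_apply, tableauEntry_lt (mem_gtPatterns.1 hx1) hc,
        (mem_gtPatterns.1 hx1).top _ _ le_rfl]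
      exact hc

/-! ### Products of Schur functions are Schur-positive -/

theorem exists_youngDiagram_rowLen_eq {f : ℕ → ℕ} (hf : Antitone f) {N : ℕ} (hN : f N = 0) :
    ∃ ν : YoungDiagram, ν.rowLen = f := by
  have hmem : ∀ p : ℕ × ℕ,
      p ∈ (Finset.range N ×ˢ Finset.range (f 0)).filter (fun p => p.2 < f p.1) ↔ p.2 < f p.1 := by
    intro p
    simp only [Finset.mem_filter, Finset.mem_product, Finset.mem_range, and_iff_right_iff_imp]
    refine fun h => ⟨?_, h.trans_le (hf (Nat.zero_le _))⟩
    by_contra hp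
    have := hf (not_lt.1 hp)
    omega
  refine ⟨⟨(Finset.range N ×ˢ Finset.range (f 0)).filter (fun p => p.2 < f p.1), ?_⟩, ?_⟩
  · intro p q hqp hp
    rw [Finset.mem_coe, hmem] at *
    exact (hqp.2.trans_lt hp).trans_le (hf hqp.1)
  · funext r
    refine eq_of_forall_lt_iff fun c => ?_
    rw [← YoungDiagram.mem_iff_lt_rowLen, ← YoungDiagram.mem_cells]
    exact hmem (r, c)

/-! ### Independence of the Littlewood–Richardson patterns from the number of variables. -/

section Stability

variable {l μ : ℕ → ℕ} {N L : ℕ} {x : ℕ → ℕ → ℕ}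

theorem IsGT.gtWeight_of_top_le (h : IsGT μ N x) (J : ℕ) {k : ℕ} (hk : N ≤ k) :
    gtWeight L J x k = 0 := by
  rw [gtWeight_eq_sum h]
  exact Finset.sum_eq_zero fun r _ => by
    rw [h.top k r hk, h.top (k + 1) r (by omega), Nat.sub_self]

theorem antitone_of_good (hl : Antitone l) (h : IsGT μ N x) (hg : GoodFrom l N L 0 x) :
    Antitone fun k => l k + gtWeight L 0 x k := by
  refine antitone_nat_of_succ_le fun k => ?_
  by_cases hk : k + 1 < N
  · exact hg k hk
  · rw [h.gtWeight_of_top_le 0 (by omega)]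
    have := hl (Nat.le_succ k)
    simp only [Nat.succ_eq_add_one] at this
    omega

theorem sum_gtWeight (h : IsGT μ N x) (k : ℕ) :
    ∑ j ∈ Finset.range k, gtWeight L 0 x j = gtSize L 0 x k := by
  induction k with
  | zero => simp [gtSize, h.zero]
  | succ k ih => rw [Finset.sum_range_succ, ih, add_comm, gtWeight_add_gtSize h]

/-- The set of Littlewood–Richardson patterns is independent of the number of variables, once
this number is at least `|λ| + |μ|`. -/
theorem lrPatterns_eq_of_le (hl : Antitone l) (hlL : ∀ r, L ≤ r → l r = 0)
    (hL : ∀ r, L ≤ r → μ r = 0) {N₀ : ℕ}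
    (hN₀ : ∑ r ∈ Finset.range L, l r + ∑ r ∈ Finset.range L, μ r ≤ N₀) (hN : N₀ ≤ N) :
    lrPatterns l μ N L = lrPatterns l μ N₀ L := by
  ext x
  rw [mem_lrPatterns, mem_lrPatterns]
  constructor
  · rintro ⟨h, hg⟩
    have ha := antitone_of_good hl h (hg 0)
    have hw : ∀ k, N₀ ≤ k → gtWeight L 0 x k = 0 := by
      intro k hk
      by_contra hne
      -- If a letter `k ≥ N₀` occurred, the partition `λ` plus content would have at least `k + 1`
      -- nonzero parts, more than its size allows.
      have h1 : ∑ j ∈ Finset.range (k + 1), (l j + gtWeight L 0 x j) ≥ k + 1 := by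
        have : ∀ j ∈ Finset.range (k + 1), 1 ≤ l j + gtWeight L 0 x j := fun j hj => by
          have := ha (Nat.lt_succ_iff.1 (Finset.mem_range.1 hj))
          simp only at this
          omega
        simpa using Finset.sum_le_sum this
      rw [Finset.sum_add_distrib, sum_gtWeight h] at h1
      have h2 : ∑ j ∈ Finset.range (k + 1), l j ≤ ∑ j ∈ Finset.range L, l j := by
        refine Finset.sum_le_sum_of_ne_zero fun j _ hj => ?_
        rw [Finset.mem_range]
        by_contra hjL
        exact hj (hlL j (not_lt.1 hjL))
      have h3 : gtSize L 0 x (k + 1) ≤ ∑ r ∈ Finset.range L, μ r :=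
        Finset.sum_le_sum fun r _ => h.le_top _ _
      omega
    have hx : ∀ k r, x (N₀ + k) r = x N₀ r := by
      intro k r
      induction k with
      | zero => rfl
      | succ k ih =>
        rw [← ih]
        by_cases hr : r < L
        · have := hw (N₀ + k) (Nat.le_add_right _ _)
          rw [gtWeight_eq_sum h, Finset.sum_eq_zero_iff] at this
          have h1 := this r (Finset.mem_range.2 hr)
          have h2 := h.mono (N₀ + k) r
          rw [← add_assoc]
          omega
        · have h1 := h.le_top (N₀ + k) r
          have h2 := h.le_top (N₀ + (k + 1)) r
          rw [hL r (not_lt.1 hr)] at h1 h2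
          omega
    refine ⟨⟨h.zero, h.mono, h.interlace, fun i r hi => ?_⟩, fun J i hi => hg J i (by omega)⟩
    have e1 := hx (i - N₀) r
    have e2 := hx (N - N₀) r
    rw [Nat.add_sub_cancel' hi] at e1
    rw [Nat.add_sub_cancel' hN, h.top N r le_rfl] at e2
    rw [e1, e2]
  · rintro ⟨h, hg⟩
    refine ⟨⟨h.zero, h.mono, h.interlace, fun i r hi => h.top i r (hN.trans hi)⟩,
      fun J i hi => ?_⟩
    by_cases hi' : i + 1 < N₀
    · exact hg J i hi'
    · rw [h.gtWeight_of_top_le J (by omega)]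
      have := hl (Nat.le_succ i)
      simp only [Nat.succ_eq_add_one] at this
      omega

end Stability

/-- For every `N ≥ N₀` the truncated product expands over one and the same set of patterns, so the
truncated identities assemble to one of power series. -/
theorem exists_schur_mul_schur (l μ : YoungDiagram) :
    ∃ (s : Finset (ℕ → ℕ → ℕ)) (ν : (ℕ → ℕ → ℕ) → YoungDiagram),
      schur l * schur μ = ∑ x ∈ s, schur (ν x) := by
  classical
  set L := max (l.colLen 0) (μ.colLen 0)
  have hz : ∀ (κ : YoungDiagram) r, κ.colLen 0 ≤ r → κ.rowLen r = 0 := fun κ r hr => by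
    by_contra hne
    have := YoungDiagram.mem_iff_lt_colLen.1
      (YoungDiagram.mem_iff_lt_rowLen.2 (Nat.pos_of_ne_zero hne))
    omega
  have hl : ∀ r, L ≤ r → l.rowLen r = 0 := fun r hr => hz l r ((le_max_left _ _).trans hr)
  have hμ : ∀ r, L ≤ r → μ.rowLen r = 0 := fun r hr => hz μ r ((le_max_right _ _).trans hr)
  have hla : Antitone l.rowLen := fun a b h => l.rowLen_anti a b h
  -- The first bound leaves enough variables for all rows of `l`; the second is the stability bound
  -- of `lrPatterns_eq_of_le`.
  set N₀ := max L (∑ r ∈ Finset.range L, l.rowLen r + ∑ r ∈ Finset.range L, μ.rowLen r)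
  have hν : ∀ x, ∃ ν : YoungDiagram, x ∈ lrPatterns l.rowLen μ.rowLen N₀ L →
      ν.rowLen = fun k => l.rowLen k + gtWeight L 0 x k := by
    intro x
    by_cases hx : x ∈ lrPatterns l.rowLen μ.rowLen N₀ L
    · obtain ⟨h, hg⟩ := mem_lrPatterns.1 hx
      obtain ⟨ν, hν⟩ := exists_youngDiagram_rowLen_eq (antitone_of_good hla h (hg 0)) (N := N₀)
        (by rw [h.gtWeight_of_top_le 0 le_rfl, hl _ (le_max_left _ _)])
      exact ⟨ν, fun _ => hν⟩
    -- A default value; only patterns in the index set are summed over.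
    · exact ⟨⊥, fun h => absurd h hx⟩
  choose ν hν using hν
  refine ⟨lrPatterns l.rowLen μ.rowLen N₀ L, ν, eq_of_truncVars_eq N₀ fun N hN => ?_⟩
  have hLN : L ≤ N := (le_max_left _ _).trans hN
  have hinj : Function.Injective
      fun k : Fin N => (MvPowerSeries.X (k : ℕ) : MvPowerSeries ℕ ℂ) := fun a b hab =>
    Fin.ext (MvPowerSeries.X_inj.1 hab)
  have : CharZero (MvPowerSeries ℕ ℂ) :=
    charZero_of_injective_algebraMap (R := ℂ) (algebraMap ℂ (MvPowerSeries ℕ ℂ)).injective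
  rw [map_mul, map_sum, truncVars_schur l N N fun r hr => hl r (hLN.trans hr),
    truncVars_schur μ N L hμ, gtSchur_mul_gtSchur hla (fun r hr => hl r (hLN.trans hr)) hμ le_rfl
    (fun r hr => hl r (hLN.trans hr)) _ hinj fun x hx => ?_,
    lrPatterns_eq_of_le hla hl hμ (le_max_right _ _) hN]
  · refine Finset.sum_congr rfl fun x hx => ?_
    have hx' := mem_lrPatterns.1 hx
    rw [truncVars_schur (ν x) N N, hν x hx]
    intro r hr
    simp only [hν x hx]
    rw [hx'.1.gtWeight_of_top_le 0 (hN.trans hr), hl r (hLN.trans hr)]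
  · obtain ⟨h, hg⟩ := mem_lrPatterns.1 hx
    exact ⟨antitone_of_good hla h (hg 0), fun k hk => h.gtWeight_of_top_le 0 hk⟩

theorem isSchurPositive_zero : IsSchurPositive 0 := ⟨0, by simp, by simp⟩

theorem IsSchurPositive.add {f g : MvPowerSeries ℕ ℂ} (hf : IsSchurPositive f)
    (hg : IsSchurPositive g) : IsSchurPositive (f + g) := by
  classical
  obtain ⟨c, hc, rfl⟩ := hf
  obtain ⟨d, hd, rfl⟩ := hg
  refine ⟨c + d, fun μ => add_nonneg (hc μ) (hd μ), ?_⟩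
  rw [Finsupp.sum_add_index']
  · simp
  · intro μ a b
    rw [Complex.ofReal_add, add_smul]

theorem IsSchurPositive.smul {f : MvPowerSeries ℕ ℂ} (hf : IsSchurPositive f) {a : ℝ}
    (ha : 0 ≤ a) : IsSchurPositive ((a : ℂ) • f) := by
  obtain ⟨c, hc, rfl⟩ := hf
  refine ⟨a • c, fun μ => mul_nonneg ha (hc μ), ?_⟩
  rw [Finsupp.sum_smul_index (by simp), Finsupp.smul_sum]
  simp [mul_smul]

theorem isSchurPositive_sum {ι : Type*} (s : Finset ι) (f : ι → MvPowerSeries ℕ ℂ)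
    (h : ∀ i ∈ s, IsSchurPositive (f i)) : IsSchurPositive (∑ i ∈ s, f i) :=
  Finset.sum_induction f IsSchurPositive (fun _ _ => IsSchurPositive.add) isSchurPositive_zero h

theorem isSchurPositive_schur (μ : YoungDiagram) : IsSchurPositive (schur μ) :=
  ⟨Finsupp.single μ 1, fun ν => Finsupp.single_nonneg.2 zero_le_one ν, by
    rw [Finsupp.sum_single_index (by simp), Complex.ofReal_one, one_smul]⟩

theorem IsSchurPositive.mul {f g : MvPowerSeries ℕ ℂ} (hf : IsSchurPositive f)
    (hg : IsSchurPositive g) : IsSchurPositive (f * g) := by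
  obtain ⟨c, hc, rfl⟩ := hf
  obtain ⟨d, hd, rfl⟩ := hg
  rw [Finsupp.sum, Finsupp.sum, Finset.sum_mul_sum]
  refine isSchurPositive_sum _ _ fun l _ => isSchurPositive_sum _ _ fun μ _ => ?_
  rw [smul_mul_smul_comm, ← Complex.ofReal_mul]
  refine IsSchurPositive.smul ?_ (mul_nonneg (hc l) (hd μ))
  obtain ⟨s, ν, h⟩ := exists_schur_mul_schur l μ
  rw [h]
  exact isSchurPositive_sum _ _ fun x _ => isSchurPositive_schur _

/-- Provides Schur-positivity of the empty product. -/
theorem schur_bot : schur ⊥ = 1 := by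
  classical
  ext d
  rw [MvPowerSeries.coeff_one, MvPowerSeries.coeff_apply, schur]
  simp only [YoungDiagram.cells_bot, Finset.sum_empty]
  have : Subsingleton (SemistandardYoungTableau ⊥) :=
    ⟨fun S T => by
      ext i j
      rw [S.zeros (YoungDiagram.notMem_bot _), T.zeros (YoungDiagram.notMem_bot _)]⟩
  split_ifs with h
  · subst h
    have : Unique {_T : SemistandardYoungTableau ⊥ // (0 : ℕ →₀ ℕ) = 0} :=
      ⟨⟨⟨SemistandardYoungTableau.highestWeight ⊥, rfl⟩⟩, fun T => Subsingleton.elim _ _⟩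
    rw [Nat.card_unique, Nat.cast_one]
  · have : IsEmpty {_T : SemistandardYoungTableau ⊥ // (0 : ℕ →₀ ℕ) = d} :=
      ⟨fun T => h T.2.symm⟩
    rw [Nat.card_of_isEmpty, Nat.cast_zero]

theorem isSchurPositive_one : IsSchurPositive 1 := schur_bot ▸ isSchurPositive_schur ⊥

theorem isSchurPositive_prod {ι : Type*} (s : Finset ι) (f : ι → MvPowerSeries ℕ ℂ)
    (h : ∀ i ∈ s, IsSchurPositive (f i)) : IsSchurPositive (∏ i ∈ s, f i) :=
  Finset.prod_induction f IsSchurPositive (fun _ _ => IsSchurPositive.mul) isSchurPositive_one h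

theorem isSymmetricFunction_one : IsSymmetricFunction 1 := by
  classical
  intro e d
  rw [MvPowerSeries.coeff_one, MvPowerSeries.coeff_one]
  congr 1
  rw [eq_iff_iff, ← Finsupp.mapDomain_zero (f := e)]
  exact (Finsupp.mapDomain_injective e.injective).eq_iff

theorem IsSymmetricFunction.mul {f g : MvPowerSeries ℕ ℂ} (hf : IsSymmetricFunction f)
    (hg : IsSymmetricFunction g) : IsSymmetricFunction (f * g) := by
  classical
  intro e d
  rw [MvPowerSeries.coeff_mul, MvPowerSeries.coeff_mul]
  have hinv : ∀ (e : Equiv.Perm ℕ) (a : ℕ →₀ ℕ),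
      Finsupp.mapDomain e (Finsupp.mapDomain e.symm a) = a := fun e a => by
    rw [← Finsupp.mapDomain_comp]; simp
  refine (Finset.sum_bij' (fun p _ => (p.1.mapDomain e, p.2.mapDomain e))
    (fun p _ => (p.1.mapDomain e.symm, p.2.mapDomain e.symm)) ?_ ?_ ?_ ?_ ?_).symm
  · intro p hp
    rw [Finset.HasAntidiagonal.mem_antidiagonal] at hp ⊢
    rw [← hp, Finsupp.mapDomain_add]
  · intro p hp
    rw [Finset.HasAntidiagonal.mem_antidiagonal] at hp ⊢
    rw [← Finsupp.mapDomain_add, hp]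
    simpa using hinv e.symm d
  · intro p _
    exact Prod.ext (by simpa using hinv e.symm p.1) (by simpa using hinv e.symm p.2)
  · intro p _
    exact Prod.ext (hinv e p.1) (hinv e p.2)
  · intro p _
    rw [hf, hg]

theorem isSymmetricFunction_prod {ι : Type*} (s : Finset ι) (f : ι → MvPowerSeries ℕ ℂ)
    (h : ∀ i ∈ s, IsSymmetricFunction (f i)) : IsSymmetricFunction (∏ i ∈ s, f i) :=
  Finset.prod_induction f IsSymmetricFunction (fun _ _ => IsSymmetricFunction.mul)
    isSymmetricFunction_one h

/-! ### Fundamental quasisymmetric functions and sorted words -/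

section Labelings

variable {α : Type*} [LinearOrder α]

/-- The strict total order on letters comparing first the labels and then the letters. -/
def LabelLT (g : α → ℕ) (a b : α) : Prop := g a < g b ∨ g a = g b ∧ a < b

theorem LabelLT.trans {g : α → ℕ} {a b c : α} (h₁ : LabelLT g a b) (h₂ : LabelLT g b c) :
    LabelLT g a c := by
  rcases h₁ with h₁ | ⟨h₁, h₁'⟩ <;> rcases h₂ with h₂ | ⟨h₂, h₂'⟩
  · exact Or.inl (h₁.trans h₂)
  · exact Or.inl (h₂ ▸ h₁)
  · exact Or.inl (h₁ ▸ h₂)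
  · exact Or.inr ⟨h₁.trans h₂, h₁'.trans h₂'⟩

theorem LabelLT.irrefl (g : α → ℕ) (a : α) : ¬LabelLT g a a := by
  simp [LabelLT]

theorem labelLT_trichotomy (g : α → ℕ) (a b : α) : LabelLT g a b ∨ a = b ∨ LabelLT g b a := by
  unfold LabelLT
  rcases lt_trichotomy (g a) (g b) with h | h | h
  · exact Or.inl (Or.inl h)
  · rcases lt_trichotomy a b with h' | h' | h'
    · exact Or.inl (Or.inr ⟨h, h'⟩)
    · exact Or.inr (Or.inl h')
    · exact Or.inr (Or.inr (Or.inr ⟨h.symm, h'⟩))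
  · exact Or.inr (Or.inr (Or.inl h))

theorem eq_of_perm_of_pairwise_labelLT {g : α → ℕ} {v w : List α} (h : v.Perm w)
    (hv : v.Pairwise (LabelLT g)) (hw : w.Pairwise (LabelLT g)) : v = w :=
  h.eq_of_pairwise (fun a _ _ _ h₁ h₂ => absurd (h₁.trans h₂) (LabelLT.irrefl g a)) hv hw

theorem exists_perm_pairwise_labelLT (g : α → ℕ) {w : List α} (hw : w.Nodup) :
    ∃ v : List α, v.Perm w ∧ v.Pairwise (LabelLT g) := by
  classical
  let r : α → α → Prop := fun a b => LabelLT g a b ∨ a = b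
  have : Std.Total r := ⟨fun a b => by
    rcases labelLT_trichotomy g a b with h | h | h
    · exact Or.inl (Or.inl h)
    · exact Or.inl (Or.inr h)
    · exact Or.inr (Or.inl h)⟩
  have : IsTrans α r := ⟨fun a _ c h₁ h₂ => by
    rcases h₁ with h₁ | rfl
    · rcases h₂ with h₂ | rfl
      · exact Or.inl (h₁.trans h₂)
      · exact Or.inl h₁
    · exact h₂⟩
  have hp := List.perm_insertionSort r w
  refine ⟨w.insertionSort r, hp, ?_⟩
  exact (List.pairwise_insertionSort r w).imp₂ (fun a b h hne => h.resolve_right hne)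
    (hp.nodup_iff.2 hw)

variable [Fintype α]

/-- The maps from the alphabet to `{0, …, N - 1}` vanishing outside `U`. -/
def labelings (N : ℕ) (U : Finset α) : Finset (α → ℕ) :=
  Fintype.piFinset fun a => if a ∈ U then Finset.range N else {0}

theorem mem_labelings {N : ℕ} {U : Finset α} {g : α → ℕ} :
    g ∈ labelings N U ↔ (∀ a ∈ U, g a < N) ∧ ∀ a ∉ U, g a = 0 := by
  rw [labelings, Fintype.mem_piFinset]
  constructor
  · intro h
    refine ⟨fun a ha => ?_, fun a ha => ?_⟩
    · simpa [ha] using h a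
    · simpa [ha] using h a
  · rintro ⟨h₁, h₂⟩ a
    split_ifs with ha
    · exact Finset.mem_range.2 (h₁ a ha)
    · exact Finset.mem_singleton.2 (h₂ a ha)

omit [Fintype α] in
theorem succ_mem_des {w : List α} {j : ℕ} (hj : j + 1 < w.length) :
    j + 1 ∈ Des w ↔ w[j + 1] < w[j] := by
  simp [Des, hj]

-- By transitivity only consecutive letters matter: their labels increase weakly, and a tie is
-- allowed exactly when the letters ascend.
omit [Fintype α] in
theorem pairwise_labelLT_iff (w : List α) (hw : w.Nodup) (g : α → ℕ) :
    w.Pairwise (LabelLT g) ↔ Monotone (fun j : Fin w.length => g w[j]) ∧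
      ∀ (j : ℕ) (h : j + 1 < w.length), j + 1 ∈ Des w → g w[j] < g w[j + 1] := by
  constructor
  · intro h
    rw [List.pairwise_iff_getElem] at h
    refine ⟨fun a b hab => ?_, fun j hj hd => ?_⟩
    · rcases hab.eq_or_lt with rfl | hlt
      · exact le_rfl
      · rcases h a b a.2 b.2 hlt with h' | h'
        · exact h'.le
        · exact h'.1.le
    · rw [succ_mem_des hj] at hd
      rcases h j (j + 1) (by omega) hj (Nat.lt_succ_self j) with h' | h'
      · exact h'
      · exact absurd h'.2 hd.asymm
  · rintro ⟨h₁, h₂⟩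
    have : IsTrans α (LabelLT g) := ⟨fun _ _ _ => LabelLT.trans⟩
    rw [← List.isChain_iff_pairwise, List.isChain_iff_getElem]
    intro j hj
    have hle : g w[j] ≤ g w[j + 1] :=
      h₁ (show (⟨j, by omega⟩ : Fin w.length) ≤ ⟨j + 1, hj⟩ from Nat.le_succ j)
    rcases lt_trichotomy w[j] w[j + 1] with h | h | h
    · rcases hle.eq_or_lt with h' | h'
      · exact Or.inr ⟨h', h⟩
      · exact Or.inl h'
    · exact absurd ((hw.getElem_inj_iff).1 h) (by omega)
    · exact Or.inl (h₂ j hj ((succ_mem_des hj).2 h))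

open Classical in
/-- The fundamental quasisymmetric function of a word `w` enumerates the labelings for which
`w` is sorted. -/
theorem truncVars_fundamentalQSym (N : ℕ) (w : List α) (hw : w.Nodup) :
    truncVars N (fundamentalQSym w.length (Des w)) =
      ∑ g ∈ labelings N w.toFinset with w.Pairwise (LabelLT g),
        ∏ a ∈ w.toFinset, (MvPowerSeries.X (g a) : MvPowerSeries ℕ ℂ) := by
  have hsum : ∀ g : α → ℕ, ∑ a ∈ w.toFinset, Finsupp.single (g a) 1 =
      ∑ j : Fin w.length, Finsupp.single (g w[j]) 1 := fun g => by
    rw [List.sum_toFinset _ hw, ← Fin.sum_univ_fun_getElem]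
    rfl
  rw [truncVars_eq_sum N _ fun g : α → ℕ => ∑ a ∈ w.toFinset, Finsupp.single (g a) 1]
  · refine Finset.sum_congr rfl fun g _ => ?_
    rw [monomial_eq_prod_X]
    simp
  · intro g hg k hk
    rw [Finsupp.finsetSum_apply]
    refine Finset.sum_eq_zero fun a ha => Finsupp.single_eq_of_ne ?_
    have := (mem_labelings.1 (Finset.mem_filter.1 hg).1).1 a ha
    omega
  · intro d hd
    rw [fundamentalQSym, ← Nat.card_eq_finsetCard]
    congr 1
    have hinv : ∀ f : Fin w.length → ℕ, (fun j : Fin w.length =>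
        (fun a => if h : a ∈ w then f ⟨w.idxOf a, List.idxOf_lt_length_of_mem h⟩ else 0) w[j]) =
          f := fun f => by
      funext j
      simp [hw.idxOf_getElem]
    refine Nat.card_congr
      { toFun := fun f => ⟨fun a => if h : a ∈ w then
          f.1 ⟨w.idxOf a, List.idxOf_lt_length_of_mem h⟩ else 0, ?_⟩
        invFun := fun g => ⟨fun j => g.1 w[j], ?_⟩
        left_inv := fun f => Subtype.ext (hinv f.1)
        right_inv := fun g => Subtype.ext ?_ }
    · obtain ⟨f, hf₁, hf₂, hf₃⟩ := f
      have hf := hinv f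
      set g : α → ℕ := fun a => if h : a ∈ w then
        f ⟨w.idxOf a, List.idxOf_lt_length_of_mem h⟩ else 0
      have hg : ∀ j (hj : j < w.length), g w[j] = f ⟨j, hj⟩ := fun j hj => congrFun hf ⟨j, hj⟩
      rw [Finset.mem_filter, Finset.mem_filter, mem_labelings, pairwise_labelLT_iff w hw, hsum]
      refine ⟨⟨⟨fun a ha => ?_, fun a ha => ?_⟩, ?_, ?_⟩, ?_⟩
      · obtain ⟨j, hj, rfl⟩ := List.getElem_of_mem (List.mem_toFinset.1 ha)
        rw [hg]
        by_contra hN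
        have h0 := hd _ (not_lt.1 hN)
        rw [← hf₃, Finsupp.finsetSum_apply] at h0
        have := Finset.sum_eq_zero_iff.1 h0 ⟨j, hj⟩ (Finset.mem_univ _)
        simp at this
      · exact dif_neg (by simpa using ha)
      · rw [hf]; exact hf₁
      · intro j hj hD
        rw [hg, hg]
        exact hf₂ j hj hD
      · rw [← hf₃]
        exact Finset.sum_congr rfl fun j _ => by rw [← hg j.1 j.2]; rfl
    · obtain ⟨g, hg⟩ := g
      rw [Finset.mem_filter, Finset.mem_filter, pairwise_labelLT_iff w hw, hsum] at hg
      exact ⟨hg.1.2.1, hg.1.2.2, hg.2⟩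
    · obtain ⟨g, hg⟩ := g
      funext a
      simp only
      split_ifs with ha
      · simp
      · rw [Finset.mem_filter, Finset.mem_filter, mem_labelings] at hg
        exact (hg.1.1.2 a (by simpa using ha)).symm

end Labelings

/-! ### The fundamental quasisymmetric functions of the shuffles of a family of words -/

section Shuffle

variable {α : Type*} [LinearOrder α] [Fintype α] {ι : Type*} [Fintype ι]

omit [Fintype α] in
theorem perm_of_isPermOf {U : Finset α} {v w : List α} (hv : IsPermOf U v) (hw : IsPermOf U w) :
    v.Perm w :=
  (List.perm_ext_iff_of_nodup hv.1 hw.1).2 fun a => by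
    rw [← List.mem_toFinset, hv.2, ← hw.2, List.mem_toFinset]

omit [Fintype α] in
theorem IsPermOf.mem_iff {U : Finset α} {w : List α} (hw : IsPermOf U w) {a : α} :
    a ∈ w ↔ a ∈ U := by
  rw [← hw.2, List.mem_toFinset]

theorem isPermOf_filter {U : Finset α} {σ π : List α} (hσ : IsPermOf U σ)
    (hπ : IsPermOf Finset.univ π) : IsPermOf U (π.filter fun a => a ∈ σ) := by
  refine ⟨hπ.1.filter _, ?_⟩
  ext a
  rw [List.mem_toFinset, List.mem_filter, hπ.mem_iff]
  simp [hσ.mem_iff]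

open Classical in
/-- For a given labeling, there is exactly one sorted shuffle of a family of sorted words. -/
theorem card_filter_sorted_shuffles (U : ι → Finset α) (σ : ι → List α)
    (hσ : ∀ i, IsPermOf (U i) (σ i)) (S : Finset (List α)) (hS : ∀ π, π ∈ S ↔
      IsPermOf Finset.univ π ∧ ∀ i, π.filter (fun a => a ∈ σ i) = σ i) (g : α → ℕ) :
    (S.filter fun π => π.Pairwise (LabelLT g)).card =
      if ∀ i, (σ i).Pairwise (LabelLT g) then 1 else 0 := by
  split_ifs with h
  · obtain ⟨π, hπ, hs⟩ := 
      exists_perm_pairwise_labelLT g (Finset.nodup_toList (Finset.univ : Finset α))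
    have hπ' : IsPermOf Finset.univ π :=
      ⟨hπ.nodup_iff.2 (Finset.nodup_toList _), by
        ext a; simp [hπ.mem_iff]⟩
    rw [Finset.card_eq_one]
    refine ⟨π, Finset.eq_singleton_iff_unique_mem.2 ⟨?_, fun ρ hρ => ?_⟩⟩
    · rw [Finset.mem_filter, hS]
      -- The restriction of the sorted word to the letters of `U i` is sorted, and `σ i` is the only
      -- sorted word on these letters.
      exact ⟨⟨hπ', fun i => eq_of_perm_of_pairwise_labelLT
        (perm_of_isPermOf (isPermOf_filter (hσ i) hπ') (hσ i)) (hs.filter _) (h i)⟩, hs⟩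
    · rw [Finset.mem_filter, hS] at hρ
      exact eq_of_perm_of_pairwise_labelLT (perm_of_isPermOf hρ.1.1 hπ') hρ.2 hs
  · rw [Finset.card_eq_zero, Finset.filter_eq_empty_iff]
    intro π hπ hs
    refine h fun i => ?_
    rw [← ((hS π).1 hπ).2 i]
    exact hs.filter _

/-- After interchanging summations, each labeling contributes its monomial times its number of
sorted shuffles, which is one or zero. Describing `S` by `hS` lets the result serve both `shuffles`
and `familyShuffles`. -/
theorem sum_fundamentalQSym_shuffles (U : ι → Finset α)
    (hdisj : ∀ i j a, a ∈ U i → a ∈ U j → i = j)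
    (hcov : ∀ a, ∃ i, a ∈ U i) (σ : ι → List α) (hσ : ∀ i, IsPermOf (U i) (σ i))
    (S : Finset (List α)) (hS : ∀ π, π ∈ S ↔
      IsPermOf Finset.univ π ∧ ∀ i, π.filter (fun a => a ∈ σ i) = σ i) :
    ∑ π ∈ S, fundamentalQSym π.length (Des π) =
      ∏ i, fundamentalQSym (σ i).length (Des (σ i)) := by
  classical
  refine eq_of_truncVars_eq 0 fun N _ => ?_
  choose idx hidx using hcov
  have hU : ∀ i, Finset.univ.filter (fun a => idx a = i) = U i := fun i => by
    ext a
    simp only [Finset.mem_filter, Finset.mem_univ, true_and]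
    exact ⟨fun h => h ▸ hidx a, fun h => hdisj _ _ a (hidx a) h⟩
  have hL : truncVars N (∑ π ∈ S, fundamentalQSym π.length (Des π)) =
      ∑ g ∈ labelings N (Finset.univ : Finset α) with ∀ i, (σ i).Pairwise (LabelLT g),
        ∏ a : α, (MvPowerSeries.X (g a) : MvPowerSeries ℕ ℂ) := by
    have h1 : ∀ π ∈ S, truncVars N (fundamentalQSym π.length (Des π)) =
        ∑ g ∈ labelings N (Finset.univ : Finset α), if π.Pairwise (LabelLT g) then
          ∏ a : α, (MvPowerSeries.X (g a) : MvPowerSeries ℕ ℂ) else 0 := fun π hπ => by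
      have h := ((hS π).1 hπ).1
      rw [truncVars_fundamentalQSym N π h.1, h.2, Finset.sum_filter]
    rw [map_sum, Finset.sum_congr rfl h1, Finset.sum_comm, Finset.sum_filter]
    refine Finset.sum_congr rfl fun g _ => ?_
    rw [← Finset.sum_filter, Finset.sum_const,
      card_filter_sorted_shuffles U σ hσ S hS g]
    split_ifs <;> simp
  rw [hL, map_prod]
  simp only [fun i => truncVars_fundamentalQSym N (σ i) (hσ i).1, fun i => (hσ i).2]
  rw [Finset.prod_univ_sum]
  -- Restrict a labeling to the blocks, extending by zero; conversely, glue by reading each letter's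
  -- label from its own block.
  refine Finset.sum_bij' (fun g _ i a => if a ∈ U i then g a else 0)
    (fun p _ a => p (idx a) a) ?_ ?_ ?_ ?_ ?_
  · intro g hg
    obtain ⟨hg, hs⟩ := Finset.mem_filter.1 hg
    rw [Fintype.mem_piFinset]
    intro i
    rw [Finset.mem_filter, mem_labelings]
    refine ⟨⟨fun a ha => ?_, fun a ha => if_neg ha⟩, (hs i).imp_of_mem fun {a b} ha hb h => ?_⟩
    · rw [if_pos ha]
      exact (mem_labelings.1 hg).1 a (Finset.mem_univ a)
    · rw [LabelLT, if_pos ((hσ i).mem_iff.1 ha), if_pos ((hσ i).mem_iff.1 hb)]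
      exact h
  · intro p hp
    rw [Fintype.mem_piFinset] at hp
    rw [Finset.mem_filter, mem_labelings]
    refine ⟨⟨fun a _ => ?_, fun a ha => absurd (Finset.mem_univ a) ha⟩, fun i => ?_⟩
    · exact (mem_labelings.1 (Finset.mem_filter.1 (hp (idx a))).1).1 a (hidx a)
    · refine (Finset.mem_filter.1 (hp i)).2.imp_of_mem fun {a b} ha hb h => ?_
      rw [LabelLT, hdisj _ _ a (hidx a) ((hσ i).mem_iff.1 ha),
        hdisj _ _ b (hidx b) ((hσ i).mem_iff.1 hb)]
      exact h
  · intro g _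
    funext a
    exact if_pos (hidx a)
  · intro p hp
    rw [Fintype.mem_piFinset] at hp
    funext i a
    simp only
    split_ifs with ha
    · rw [hdisj _ _ a (hidx a) ha]
    · exact ((mem_labelings.1 (Finset.mem_filter.1 (hp i)).1).2 a ha).symm
  · intro g _
    rw [← Finset.prod_fiberwise Finset.univ idx]
    refine Finset.prod_congr rfl fun i _ => ?_
    rw [hU]
    exact Finset.prod_congr rfl fun a ha => by simp only [if_pos ha]

end Shuffle

/-! ### Shuffles of multisets of words -/

/-- The distributive law for a product of sums over multisets. -/
theorem sum_map_multiset_pi {ι R : Type*} [DecidableEq ι] [CommSemiring R] {β : ι → Type*}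
    (t : ∀ i, Multiset (β i)) (f : ∀ i, β i → R) (s : Multiset ι) (hs : s.Nodup) :
    ((Multiset.pi s t).map fun p => (s.attach.map fun i => f i.1 (p i.1 i.2)).prod).sum =
      (s.map fun i => ((t i).map (f i)).sum).prod := by
  induction s using Multiset.induction with
  | empty => simp
  | cons a s ih =>
    have ha := (Multiset.nodup_cons.1 hs).1
    rw [Multiset.pi_cons, Multiset.map_cons, Multiset.prod_cons, ← ih (Multiset.nodup_cons.1 hs).2,
      Multiset.map_bind, Multiset.sum_bind, ← Multiset.sum_map_mul_right]
    refine congrArg _ (Multiset.map_congr rfl fun b _ => ?_)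
    rw [Multiset.map_map, ← Multiset.sum_map_mul_left]
    refine congrArg _ (Multiset.map_congr rfl fun p _ => ?_)
    rw [Function.comp, Multiset.attach_cons, Multiset.map_cons, Multiset.prod_cons,
      Multiset.Pi.cons_same, Multiset.map_map]
    refine congrArg _ (congrArg _ (Multiset.map_congr rfl fun i _ => ?_))
    rw [Function.comp, Multiset.Pi.cons_ne]
    exact fun h => ha (h ▸ i.2)

section Multisets

variable {α : Type*} [LinearOrder α] [Fintype α]

theorem nodup_bind_of_forall {β γ : Type*} {s : Multiset β} {t : β → Multiset γ} (hs : s.Nodup)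
    (ht : ∀ b ∈ s, (t b).Nodup) (h : ∀ b ∈ s, ∀ c ∈ s, ∀ x, x ∈ t b → x ∈ t c → b = c) :
    (s.bind t).Nodup := by
  rw [Multiset.nodup_bind]
  refine ⟨ht, ?_⟩
  induction s using Quotient.inductionOn with
  | h l =>
    refine ⟨l, rfl, ?_⟩
    refine List.Pairwise.imp_of_mem (R := fun a b => a ≠ b) ?_ hs
    intro a b ha hb hab
    exact Multiset.disjoint_left.2 fun {x} hx hx' => hab (h a ha b hb x hx hx')

section Two

variable {U V : Finset α} (hUV : Disjoint U V) (hcov : ∀ a, a ∈ U ∨ a ∈ V)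

include hUV hcov

theorem isPermOf_univ_of_mem_shuffles {σ τ π : List α} (hσ : IsPermOf U σ) (hτ : IsPermOf V τ)
    (hπ : π ∈ shuffles σ τ) : IsPermOf Finset.univ π := by
  have h := (mem_shuffles.1 hπ).1
  refine ⟨h.nodup_iff.2 (List.nodup_append'.2 ⟨hσ.1, hτ.1, ?_⟩), ?_⟩
  · exact fun a ha hb => Finset.disjoint_left.1 hUV (hσ.mem_iff.1 ha) (hτ.mem_iff.1 hb)
  · ext a
    simp [h.mem_iff, hσ.mem_iff, hτ.mem_iff, hcov a]

theorem mem_shuffles_iff {σ τ π : List α} (hσ : IsPermOf U σ) (hτ : IsPermOf V τ) :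
    π ∈ shuffles σ τ ↔ IsPermOf Finset.univ π ∧
      π.filter (fun a => a ∈ σ) = σ ∧ π.filter (fun a => a ∈ τ) = τ := by
  refine ⟨fun h => ⟨isPermOf_univ_of_mem_shuffles hUV hcov hσ hτ h, (mem_shuffles.1 h).2⟩,
    fun h => mem_shuffles.2 ⟨?_, h.2⟩⟩
  refine perm_of_isPermOf h.1 ⟨List.nodup_append'.2 ⟨hσ.1, hτ.1, ?_⟩, ?_⟩
  · exact fun a ha hb => Finset.disjoint_left.1 hUV (hσ.mem_iff.1 ha) (hτ.mem_iff.1 hb)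
  · ext a
    simp [hσ.mem_iff, hτ.mem_iff, hcov a]

variable {A B : Multiset (List α)} (hA : ∀ w ∈ A, IsPermOf U w) (hB : ∀ w ∈ B, IsPermOf V w)

include hA hB

theorem isPermOf_of_mem_shuffle (w : List α) (hw : w ∈ shuffle A B) : IsPermOf Finset.univ w := by
  obtain ⟨σ, hσ, hw⟩ := Multiset.mem_bind.1 hw
  obtain ⟨τ, hτ, hw⟩ := Multiset.mem_bind.1 hw
  exact isPermOf_univ_of_mem_shuffles hUV hcov (hA σ hσ) (hB τ hτ) hw

-- A shuffle determines its factors: each is the restriction of the shuffle to `U` or `V`,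
-- independently of which word on that letter set is tested.
omit [Fintype α] hUV hcov in
theorem nodup_shuffle (hA' : A.Nodup) (hB' : B.Nodup) : (shuffle A B).Nodup := by
  have key : ∀ {W : Finset α} {σ σ' π : List α}, IsPermOf W σ → IsPermOf W σ' →
      π.filter (fun a => a ∈ σ) = σ → π.filter (fun a => a ∈ σ') = σ' → σ = σ' := by
    intro W σ σ' π h h' e e'
    rw [← e, ← e']
    simp only [h.mem_iff, h'.mem_iff]
  refine nodup_bind_of_forall hA' (fun σ hσ => nodup_bind_of_forall hB'
    (fun τ _ => Finset.nodup _) fun τ hτ τ' hτ' π h h' => ?_) fun σ hσ σ' hσ' π h h' => ?_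
  · exact key (hB τ hτ) (hB τ' hτ') (mem_shuffles.1 h).2.2 (mem_shuffles.1 h').2.2
  · obtain ⟨τ, _, h⟩ := Multiset.mem_bind.1 h
    obtain ⟨τ', _, h'⟩ := Multiset.mem_bind.1 h'
    exact key (hA σ hσ) (hA σ' hσ') (mem_shuffles.1 h).2.1 (mem_shuffles.1 h').2.1

theorem Q_shuffle : Q (shuffle A B) = Q A * Q B := by
  rw [Q, Q, Q, shuffle, Multiset.map_bind, Multiset.sum_bind, ← Multiset.sum_map_mul_right]
  refine congrArg _ (Multiset.map_congr rfl fun σ hσ => ?_)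
  rw [Multiset.map_bind, Multiset.sum_bind, ← Multiset.sum_map_mul_left]
  refine congrArg _ (Multiset.map_congr rfl fun τ hτ => ?_)
  -- Two words form a family indexed by `Bool`.
  have := sum_fundamentalQSym_shuffles (fun b : Bool => cond b U V) ?_ ?_
    (fun b => cond b σ τ) ?_ (shuffles σ τ) ?_
  · simpa using this
  · rintro (_ | _) (_ | _) a h h'
    · rfl
    · exact absurd h (Finset.disjoint_left.1 hUV h')
    · exact absurd h' (Finset.disjoint_left.1 hUV h)
    · rfl
  · intro a
    rcases hcov a with h | h
    · exact ⟨true, h⟩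
    · exact ⟨false, h⟩
  · rintro (_ | _)
    · exact hB τ hτ
    · exact hA σ hσ
  · intro π
    rw [mem_shuffles_iff hUV hcov (hA σ hσ) (hB τ hτ), Bool.forall_bool]
    simp only [cond_true, cond_false]
    tauto

end Two

section Family

variable {m : ℕ} {U : Fin m → Finset α} (hdisj : ∀ i j a, a ∈ U i → a ∈ U j → i = j)
  (hcov : ∀ a, ∃ i, a ∈ U i)

include hdisj hcov

theorem sum_coe_eq_univ_val {σ : Fin m → List α} (hσ : ∀ i, IsPermOf (U i) (σ i)) :
    ∑ i, (σ i : Multiset α) = (Finset.univ : Finset α).val := by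
  ext a
  rw [Multiset.count_sum', Multiset.count_eq_one_of_mem (Finset.nodup _) (Finset.mem_univ a)]
  obtain ⟨i, hi⟩ := hcov a
  rw [Finset.sum_eq_single i, Multiset.coe_count,
    List.count_eq_one_of_mem (hσ i).1 ((hσ i).mem_iff.2 hi)]
  · intro j _ hj
    rw [Multiset.coe_count, List.count_eq_zero, (hσ j).mem_iff]
    exact fun h => hj (hdisj _ _ a h hi)
  · simp

theorem mem_familyShuffles_iff {σ : Fin m → List α} (hσ : ∀ i, IsPermOf (U i) (σ i))
    {π : List α} : π ∈ familyShuffles σ ↔ IsPermOf Finset.univ π ∧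
      ∀ i, π.filter (fun a => a ∈ σ i) = σ i := by
  rw [mem_familyShuffles, sum_coe_eq_univ_val hdisj hcov hσ]
  refine and_congr_left fun _ => ⟨fun h => ⟨?_, ?_⟩, fun h => ?_⟩
  · rw [← Multiset.coe_nodup, h]
    exact Finset.nodup _
  · ext a
    rw [List.mem_toFinset, ← Multiset.mem_coe, h]
    simp
  · rw [← Finset.coe_toList, Multiset.coe_eq_coe]
    exact perm_of_isPermOf h ⟨Finset.nodup_toList _, by ext; simp⟩

variable {A : Fin m → Multiset (List α)} (hA : ∀ i, ∀ w ∈ A i, IsPermOf (U i) w)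

include hA

theorem isPermOf_of_mem_familyShuffle (w : List α) (hw : w ∈ familyShuffle A) :
    IsPermOf Finset.univ w := by
  obtain ⟨σ, hσ, hw⟩ := Multiset.mem_bind.1 hw
  rw [Multiset.mem_pi] at hσ
  exact ((mem_familyShuffles_iff hdisj hcov fun i => hA i _ (hσ i _)).1 hw).1

omit [Fintype α] hdisj hcov in
theorem nodup_familyShuffle (hA' : ∀ i, (A i).Nodup) : (familyShuffle A).Nodup := by
  refine nodup_bind_of_forall (Multiset.Nodup.pi (Finset.nodup _) fun i _ => hA' i)
    (fun σ _ => Finset.nodup _) fun σ hσ σ' hσ' π h h' => ?_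
  rw [Multiset.mem_pi] at hσ hσ'
  funext i hi
  have e := (mem_familyShuffles.1 h).2 i
  have e' := (mem_familyShuffles.1 h').2 i
  rw [← e, ← e']
  simp only [(hA i _ (hσ i hi)).mem_iff, (hA i _ (hσ' i hi)).mem_iff]

theorem Q_familyShuffle : Q (familyShuffle A) = ∏ i, Q (A i) := by
  have h := sum_map_multiset_pi A (fun _ w => fundamentalQSym w.length (Des w))
    (Finset.univ : Finset (Fin m)).val (Finset.nodup _)
  rw [Finset.prod_eq_multiset_prod]
  simp only [Q]
  rw [← h, familyShuffle, Multiset.map_bind, Multiset.sum_bind]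
  refine congrArg _ (Multiset.map_congr rfl fun σ hσ => ?_)
  rw [Multiset.mem_pi] at hσ
  have := sum_fundamentalQSym_shuffles U hdisj hcov (fun i => σ i (Finset.mem_univ i))
    (fun i => hA i _ (hσ i _)) (familyShuffles fun i => σ i (Finset.mem_univ i))
    (fun π => mem_familyShuffles_iff hdisj hcov fun i => hA i _ (hσ i _))
  rw [← Finset.sum_eq_multiset_sum, this]
  exact (Finset.prod_attach Finset.univ _).symm

end Family

end Multisets

/-! ### Characters of induced representations -/

section Induced

variable {G H V : Type*} [Group G] [Group H] [Fintype G] [Fintype H] [AddCommGroup V] [Module ℂ V]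
  [FiniteDimensional ℂ V]

omit [Fintype G] [Group G] in
/-- The trace on the coinvariants is the average of the traces of the composites with the group
elements. -/
theorem trace_coinvariants_map (ρ : Representation ℂ H V)
    (f : Representation.IntertwiningMap ρ ρ) :
    LinearMap.trace ℂ _ (Representation.Coinvariants.map ρ ρ f) =
      (Fintype.card H : ℂ)⁻¹ * ∑ h, LinearMap.trace ℂ V (f.toLinearMap ∘ₗ ρ h) := by
  -- The averaging operator factors through the coinvariants as a section `s` of the quotient map;
  -- cyclicity of the trace then moves the computation to `V`.
  let P : V →ₗ[ℂ] V := (Fintype.card H : ℂ)⁻¹ • ∑ h, ρ h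
  have hP : ∀ h, P ∘ₗ ρ h = P := fun h => by
    have : ∑ k, ρ k ∘ₗ ρ h = ∑ k, ρ k := by
      simp only [← Module.End.mul_eq_comp, ← map_mul]
      exact Equiv.sum_comp (Equiv.mulRight h) fun k => ρ k
    rw [LinearMap.smul_comp, ← Module.End.mul_eq_comp, Finset.sum_mul]
    exact congrArg _ this
  let s := Representation.Coinvariants.lift ρ P hP
  have h1 : Representation.Coinvariants.mk ρ ∘ₗ s = LinearMap.id := by
    refine Representation.Coinvariants.hom_ext (LinearMap.ext fun v => ?_)
    simp only [LinearMap.comp_apply, s, Representation.Coinvariants.lift_mk, P,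
      LinearMap.smul_apply, LinearMap.sum_apply, map_smul, map_sum,
      Representation.Coinvariants.mk_self_apply, Finset.sum_const, Finset.card_univ,
      LinearMap.id_apply]
    rw [← Nat.cast_smul_eq_nsmul ℂ, inv_smul_smul₀]
    exact Nat.cast_ne_zero.2 Fintype.card_ne_zero
  have h2 : s ∘ₗ Representation.Coinvariants.mk ρ = P :=
    Representation.Coinvariants.lift_comp_mk ρ P hP
  calc LinearMap.trace ℂ _ (Representation.Coinvariants.map ρ ρ f)
      = LinearMap.trace ℂ _ ((Representation.Coinvariants.map ρ ρ f ∘ₗ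
          Representation.Coinvariants.mk ρ) ∘ₗ s) := by
        rw [LinearMap.comp_assoc, h1, LinearMap.comp_id]
    _ = LinearMap.trace ℂ _ ((Representation.Coinvariants.mk ρ ∘ₗ f.toLinearMap) ∘ₗ s) := rfl
    _ = LinearMap.trace ℂ V (f.toLinearMap ∘ₗ P) := by
        rw [LinearMap.comp_assoc, LinearMap.trace_comp_comm', LinearMap.comp_assoc, h2]
    _ = _ := by
        rw [LinearMap.comp_smul, map_smul, smul_eq_mul, ← Module.End.mul_eq_comp, Finset.mul_sum,
          map_sum]
        rfl

omit [Group G] in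
theorem trace_eq_card_fixedPoints [DecidableEq G] (F : MonoidAlgebra ℂ G →ₗ[ℂ] MonoidAlgebra ℂ G)
    (p : G → G) (hF : ∀ x, F (MonoidAlgebra.single x 1) = MonoidAlgebra.single (p x) 1) :
    LinearMap.trace ℂ _ F = ∑ x, if p x = x then 1 else 0 := by
  rw [LinearMap.trace_eq_matrix_trace ℂ (MonoidAlgebra.basis G ℂ), Matrix.trace]
  refine Finset.sum_congr rfl fun x _ => ?_
  rw [Matrix.diag_apply, LinearMap.toMatrix_apply, MonoidAlgebra.basis_apply, hF,
    ← MonoidAlgebra.basis_apply, Module.Basis.repr_self, Finsupp.single_apply]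

/-- The character of an induced representation. -/
theorem trace_ind [DecidableEq G] (e : H →* G) (ψ : Representation ℂ H V) (g : G) :
    LinearMap.trace ℂ _ (Representation.ind e ψ g) = (Fintype.card H : ℂ)⁻¹ *
      ∑ h, (∑ x, if e h * x * g⁻¹ = x then 1 else 0) * LinearMap.trace ℂ V (ψ h) := by
  have : Module.Finite ℂ (MonoidAlgebra ℂ G) := Module.Finite.of_basis (MonoidAlgebra.basis G ℂ)
  have : Module.Free ℂ (MonoidAlgebra ℂ G) := Module.Free.of_basis (MonoidAlgebra.basis G ℂ)
  -- The induced representation is realised on the `H`-coinvariants of `ℂ[G] ⊗ V`, with `g` acting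
  -- by right multiplication by `g⁻¹`. On `ℂ[G]` the composite permutes the basis, so its trace
  -- counts fixed points.
  refine (trace_coinvariants_map _ _).trans ?_
  congr 1
  refine Finset.sum_congr rfl fun h _ => ?_
  have e1 : ((MonoidAlgebra.mapDomainLinearMap ℂ ℂ fun x => x * g⁻¹).rTensor V) ∘ₗ
      (Representation.tprod ((Representation.leftRegular ℂ G).comp e) ψ h) =
      TensorProduct.map ((MonoidAlgebra.mapDomainLinearMap ℂ ℂ fun x => x * g⁻¹) ∘ₗ
        Representation.leftRegular ℂ G (e h)) (ψ h) := by
    rw [Representation.tprod_apply, LinearMap.rTensor_comp_map]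
    rfl
  refine (congrArg _ e1).trans ?_
  rw [LinearMap.trace_tensorProduct', trace_eq_card_fixedPoints _ fun x => e h * x * g⁻¹]
  intro x
  simp

end Induced

/-! ### The Frobenius characteristic of an induced representation -/

/-- The product of power sums of the cycle type. -/
def cyclePowerSum {n : ℕ} (w : Equiv.Perm (Fin n)) : MvPowerSeries ℕ ℂ :=
  (w.partition.parts.map powerSum).prod

theorem frobeniusCh_eq {n : ℕ} {V : Type*} [AddCommGroup V] [Module ℂ V]
    (ρ : Representation ℂ (Equiv.Perm (Fin n)) V) :
    frobeniusCh ρ = (n.factorial : ℂ)⁻¹ •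
      ∑ w, LinearMap.trace ℂ V (ρ w) • cyclePowerSum w := rfl

theorem cyclePowerSum_conj {n : ℕ} (x w : Equiv.Perm (Fin n)) :
    cyclePowerSum (x⁻¹ * w * x) = cyclePowerSum w := by
  have h : IsConj w (x⁻¹ * w * x) := isConj_iff.2 ⟨x⁻¹, by simp⟩
  have := Equiv.Perm.partition_eq_of_isConj.1 h
  rw [cyclePowerSum, cyclePowerSum, this]

/-- For fixed `h`, each `x` admits exactly one `g` in the induced character, namely a conjugate of
`e h`. The power sum product is a class function, so `n!` equal terms cancel the factor `1 / n!`. -/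
theorem frobeniusCh_ind {n : ℕ} {H V : Type*} [Group H] [Fintype H] [AddCommGroup V] [Module ℂ V]
    [FiniteDimensional ℂ V] (e : H →* Equiv.Perm (Fin n)) (ψ : Representation ℂ H V) :
    frobeniusCh (Representation.ind e ψ) = (Fintype.card H : ℂ)⁻¹ •
      ∑ h, LinearMap.trace ℂ V (ψ h) • cyclePowerSum (e h) := by
  have hc : ∀ (h : H) (g x : Equiv.Perm (Fin n)), e h * x * g⁻¹ = x ↔ g = x⁻¹ * e h * x :=
    fun h g x => by
      rw [mul_inv_eq_iff_eq_mul, mul_assoc, eq_inv_mul_iff_mul_eq, eq_comm]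
  have key : ∀ h : H, ∑ g, ((∑ x, if e h * x * g⁻¹ = x then (1 : ℂ) else 0) *
      LinearMap.trace ℂ V (ψ h)) • cyclePowerSum g =
        (n.factorial : ℂ) • LinearMap.trace ℂ V (ψ h) • cyclePowerSum (e h) := fun h => by
    simp only [hc, Finset.sum_mul, Finset.sum_smul]
    rw [Finset.sum_comm]
    simp only [ite_mul, one_mul, zero_mul, ite_smul, zero_smul, Finset.sum_ite_eq',
      Finset.mem_univ, if_true, cyclePowerSum_conj, Finset.sum_const, Finset.card_univ,
      Fintype.card_perm, Fintype.card_fin]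
    rw [← Nat.cast_smul_eq_nsmul ℂ]
  rw [frobeniusCh_eq]
  simp only [trace_ind, mul_smul, ← Finset.smul_sum]
  rw [smul_comm]
  congr 1
  simp only [Finset.sum_smul]
  rw [Finset.sum_comm]
  simp only [key, ← Finset.smul_sum]
  exact inv_smul_smul₀ (Nat.cast_ne_zero.2 (Nat.factorial_ne_zero n)) _

/-! ### Cycle types in Young subgroups -/

theorem cycleType_permCongr {β γ : Type*} [Fintype β] [Fintype γ] [DecidableEq β] [DecidableEq γ]
    (e : β ≃ γ) (σ : Equiv.Perm β) : (e.permCongr σ).cycleType = σ.cycleType := by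
  rw [← Equiv.Perm.cycleType_extendDomain
    (e.trans (Equiv.subtypeUnivEquiv (p := fun _ : γ => True) fun _ => trivial).symm) (g := σ)]
  congr 1

theorem cycleType_viaEmbedding {β γ : Type*} [Fintype β] [Fintype γ] [DecidableEq β]
    [DecidableEq γ] (i : β ↪ γ) (σ : Equiv.Perm β) :
    (σ.viaEmbedding i).cycleType = σ.cycleType := by
  classical
  rw [Equiv.Perm.viaEmbedding]
  convert Equiv.Perm.cycleType_extendDomain (Equiv.ofInjective i.1 i.2) (g := σ)

/-- The permutation is the product of its two parts, each extended by the identity; these are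
disjoint, so their cycle types add. -/
theorem cycleType_sumCongr {β γ : Type*} [Fintype β] [Fintype γ] [DecidableEq β] [DecidableEq γ]
    (σ : Equiv.Perm β) (τ : Equiv.Perm γ) :
    (Equiv.Perm.sumCongr σ τ).cycleType = σ.cycleType + τ.cycleType := by
  have hl : Equiv.Perm.sumCongr σ (1 : Equiv.Perm γ) = σ.viaEmbedding Function.Embedding.inl := by
    ext (b | c)
    · exact (Equiv.Perm.viaEmbedding_apply σ Function.Embedding.inl b).symm
    · exact (Equiv.Perm.viaEmbedding_apply_of_notMem σ Function.Embedding.inl (Sum.inr c)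
        (by simp)).symm
  have hr : Equiv.Perm.sumCongr (1 : Equiv.Perm β) τ = τ.viaEmbedding Function.Embedding.inr := by
    ext (b | c)
    · exact (Equiv.Perm.viaEmbedding_apply_of_notMem τ Function.Embedding.inr (Sum.inl b)
        (by simp)).symm
    · exact (Equiv.Perm.viaEmbedding_apply τ Function.Embedding.inr c).symm
  have hd : (Equiv.Perm.sumCongr σ (1 : Equiv.Perm γ)).Disjoint
      (Equiv.Perm.sumCongr (1 : Equiv.Perm β) τ) := by
    rintro (b | c)
    · right; rfl
    · left; rfl
  have := hd.cycleType_mul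
  rwa [Equiv.Perm.sumCongr_mul, mul_one, one_mul, hl, hr, cycleType_viaEmbedding,
    cycleType_viaEmbedding] at this

/-- Induction on the set of blocks allowed to move: adjoining a block multiplies by a disjoint
permutation. -/
theorem cycleType_sigmaCongrRight {m : ℕ} {β : Fin m → Type*} [∀ i, Fintype (β i)]
    [∀ i, DecidableEq (β i)] (g : ∀ i, Equiv.Perm (β i)) :
    (Equiv.Perm.sigmaCongrRight g).cycleType = ∑ i, (g i).cycleType := by
  have single : ∀ j, (Equiv.Perm.sigmaCongrRight (Pi.mulSingle j (g j))).cycleType =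
      (g j).cycleType := fun j => by
    rw [← cycleType_viaEmbedding (Function.Embedding.sigmaMk (β := β) j)]
    congr 1
    ext1 ⟨i, x⟩
    by_cases h : i = j
    · subst h
      rw [show (⟨i, x⟩ : Σ i, β i) = Function.Embedding.sigmaMk (β := β) i x from rfl,
        Equiv.Perm.viaEmbedding_apply]
      simp
    · rw [Equiv.Perm.viaEmbedding_apply_of_notMem]
      · simp [Pi.mulSingle_eq_of_ne h]
      · rintro ⟨y, hy⟩
        exact h (congrArg Sigma.fst hy).symm
  have key : ∀ s : Finset (Fin m),
      (Equiv.Perm.sigmaCongrRight fun i => if i ∈ s then g i else 1).cycleType =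
        ∑ i ∈ s, (g i).cycleType := by
    intro s
    induction s using Finset.induction_on with
    | empty =>
      simp only [Finset.notMem_empty, if_false, Finset.sum_empty]
      exact Equiv.Perm.cycleType_eq_zero.2 rfl
    | insert j s hj ih =>
      rw [Finset.sum_insert hj, ← ih, ← single j, ← Equiv.Perm.Disjoint.cycleType_mul,
        Equiv.Perm.sigmaCongrRight_mul]
      · congr 2
        funext i
        by_cases h : i = j
        · subst h; simp [hj]
        · simp [h]
      · rintro ⟨i, x⟩
        by_cases h : i = j
        · right; subst h; simp [hj]
        · left; simp [h]
  simpa using key Finset.univ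

/-- `cycleType` omits fixed points; they account for the power of `powerSum 1`. -/
theorem cyclePowerSum_eq {n : ℕ} (w : Equiv.Perm (Fin n)) :
    cyclePowerSum w = (w.cycleType.map powerSum).prod * powerSum 1 ^ (n - w.cycleType.sum) := by
  rw [cyclePowerSum, Equiv.Perm.parts_partition, Multiset.map_add, Multiset.prod_add,
    Multiset.map_replicate, Multiset.prod_replicate, Equiv.Perm.sum_cycleType, Fintype.card_fin]

theorem cyclePowerSum_youngEmb (k l : ℕ) (p : Equiv.Perm (Fin k) × Equiv.Perm (Fin l)) :
    cyclePowerSum (youngEmb k l p) = cyclePowerSum p.1 * cyclePowerSum p.2 := by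
  have h : (youngEmb k l p).cycleType = p.1.cycleType + p.2.cycleType := by
    rw [← cycleType_sumCongr, ← cycleType_permCongr finSumFinEquiv]
    rfl
  -- These bounds make the truncated subtraction counting fixed points additive.
  have h1 := p.1.sum_cycleType_le
  have h2 := p.2.sum_cycleType_le
  rw [Fintype.card_fin] at h1 h2
  rw [cyclePowerSum_eq, cyclePowerSum_eq, cyclePowerSum_eq, h, Multiset.map_add, Multiset.prod_add,
    Multiset.sum_add, show k + l - (p.1.cycleType.sum + p.2.cycleType.sum) =
      (k - p.1.cycleType.sum) + (l - p.2.cycleType.sum) by omega, pow_add]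
  ring

theorem cyclePowerSum_familyYoungEmb {m : ℕ} (η : Fin m → ℕ) (g : ∀ i, Equiv.Perm (Fin (η i))) :
    cyclePowerSum (familyYoungEmb η g) = ∏ i, cyclePowerSum (g i) := by
  have h : (familyYoungEmb η g).cycleType = ∑ i, (g i).cycleType := by
    rw [← cycleType_sigmaCongrRight, ← cycleType_permCongr finSigmaFinEquiv]
    rfl
  have h1 : ∀ i, (g i).cycleType.sum ≤ η i := fun i => by
    simpa using (g i).sum_cycleType_le
  rw [cyclePowerSum_eq, h]
  simp only [cyclePowerSum_eq, Finset.prod_mul_distrib, Finset.prod_pow_eq_pow_sum]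
  congr 1
  · exact (congrArg _ (map_sum (Multiset.mapAddMonoidHom powerSum) _ _)).trans
      (Multiset.prod_sum _ _)
  · rw [Finset.sum_tsub_distrib _ fun i _ => h1 i, Multiset.sum_sum]

/-! ### Outer tensor products -/

/-- In the product basis the diagonal entries are products of diagonal entries, and their sum is the
expanded product of the traces. -/
theorem trace_piTensorProduct_map {ι : Type*} [Fintype ι] {M : ι → Type*}
    [∀ i, AddCommGroup (M i)] [∀ i, Module ℂ (M i)] [∀ i, FiniteDimensional ℂ (M i)]
    (f : ∀ i, M i →ₗ[ℂ] M i) :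
    LinearMap.trace ℂ _ (PiTensorProduct.map f) = ∏ i, LinearMap.trace ℂ (M i) (f i) := by
  classical
  let b := fun i => Module.finBasis ℂ (M i)
  rw [LinearMap.trace_eq_matrix_trace ℂ (Basis.piTensorProduct b), Matrix.trace]
  simp only [fun i => LinearMap.trace_eq_matrix_trace ℂ (b i) (f i), Matrix.trace]
  rw [Finset.prod_univ_sum, Fintype.piFinset_univ]
  refine Finset.sum_congr rfl fun p _ => ?_
  simp [LinearMap.toMatrix_apply]

theorem finiteDimensional_piTensorProduct {ι : Type*} [Fintype ι] {M : ι → Type*}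
    [∀ i, AddCommGroup (M i)] [∀ i, Module ℂ (M i)] [∀ i, FiniteDimensional ℂ (M i)] :
    FiniteDimensional ℂ (⨂[ℂ] i, M i) :=
  Module.Finite.of_basis (Basis.piTensorProduct fun i => Module.finBasis ℂ (M i))

/-- Traces and power sum products both factor over the pair of permutations, so the average over the
Young subgroup is a product of two averages. -/
theorem frobeniusCh_ind_outerTensor {k l : ℕ} {M N : Type*} [AddCommGroup M] [Module ℂ M]
    [FiniteDimensional ℂ M] [AddCommGroup N] [Module ℂ N] [FiniteDimensional ℂ N]
    (φ : Representation ℂ (Equiv.Perm (Fin k)) M) (ψ : Representation ℂ (Equiv.Perm (Fin l)) N) :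
    frobeniusCh (Representation.ind (youngEmb k l) (outerTensor φ ψ)) =
      frobeniusCh φ * frobeniusCh ψ := by
  have ht : ∀ p, LinearMap.trace ℂ _ (outerTensor φ ψ p) =
      LinearMap.trace ℂ M (φ p.1) * LinearMap.trace ℂ N (ψ p.2) := fun p =>
    LinearMap.trace_tensorProduct' _ _
  rw [frobeniusCh_ind, frobeniusCh_eq, frobeniusCh_eq, smul_mul_smul_comm, Finset.sum_mul_sum,
    Fintype.sum_prod_type, Fintype.card_prod, Fintype.card_perm, Fintype.card_perm,
    Fintype.card_fin, Fintype.card_fin, Nat.cast_mul, mul_inv]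
  simp only [ht, cyclePowerSum_youngEmb, smul_mul_smul_comm]

theorem frobeniusCh_ind_familyOuterTensor {m : ℕ} {η : Fin m → ℕ} {M : Fin m → Type*}
    [∀ i, AddCommGroup (M i)] [∀ i, Module ℂ (M i)] [∀ i, FiniteDimensional ℂ (M i)]
    (φ : ∀ i, Representation ℂ (Equiv.Perm (Fin (η i))) (M i)) :
    frobeniusCh (Representation.ind (familyYoungEmb η) (familyOuterTensor φ)) =
      ∏ i, frobeniusCh (φ i) := by
  have := finiteDimensional_piTensorProduct (M := M)
  have ht : ∀ g, LinearMap.trace ℂ _ (familyOuterTensor φ g) =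
      ∏ i, LinearMap.trace ℂ (M i) (φ i (g i)) := fun g => trace_piTensorProduct_map _
  rw [frobeniusCh_ind]
  simp only [frobeniusCh_eq, ht, cyclePowerSum_familyYoungEmb]
  simp only [Algebra.smul_def, Finset.prod_mul_distrib, map_prod]
  congr 1
  · rw [← map_prod, Fintype.card_pi, Nat.cast_prod, ← Finset.prod_inv_distrib]
    simp only [Fintype.card_perm, Fintype.card_fin]
  · rw [Finset.prod_univ_sum, Fintype.piFinset_univ]
    simp only [Finset.prod_mul_distrib]

theorem IsFine.of_Q_eq_mul {α β γ : Type*} [LinearOrder α] [LinearOrder β] [LinearOrder γ]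
    {A : Multiset (List α)} {B : Multiset (List β)} {C : Multiset (List γ)} (hA : IsFine A)
    (hB : IsFine B) (h : Q C = Q A * Q B) : IsFine C := by
  rw [IsFine, h]
  exact ⟨hA.1.mul hB.1, hA.2.mul hB.2⟩

theorem IsFine.of_Q_eq_prod {ι α β : Type*} [LinearOrder α] [LinearOrder β] [Fintype ι]
    {A : ι → Multiset (List α)} {C : Multiset (List β)} (hA : ∀ i, IsFine (A i))
    (h : Q C = ∏ i, Q (A i)) : IsFine C := by
  rw [IsFine, h]
  exact ⟨isSymmetricFunction_prod _ _ fun i _ => (hA i).1,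
    isSchurPositive_prod _ _ fun i _ => (hA i).2⟩

end ShuffleFine

end

open ShuffleFine in
theorem lemma5p6 :
    -- two factors
    (∀ (k l : ℕ) (U V : Finset (Fin (k + l))), Disjoint U V → U ∪ V = Finset.univ →
      U.card = k → V.card = l →
      ∀ A B : Multiset (List (Fin (k + l))),
      (∀ w ∈ A, IsPermOf U w) → (∀ w ∈ B, IsPermOf V w) →
        -- the shuffle is a multiset of permutations in `S_n`, and a set if `A` and `B` are sets
        (∀ w ∈ shuffle A B, IsPermOf Finset.univ w) ∧
        (A.Nodup → B.Nodup → (shuffle A B).Nodup) ∧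
        (IsFine A → IsFine B → IsFine (shuffle A B) ∧ Q (shuffle A B) = Q A * Q B) ∧
        (∀ (M N : Type*) [AddCommGroup M] [Module ℂ M] [FiniteDimensional ℂ M]
          [AddCommGroup N] [Module ℂ N] [FiniteDimensional ℂ N]
          (φ : Representation ℂ (Equiv.Perm (Fin k)) M)
          (ψ : Representation ℂ (Equiv.Perm (Fin l)) N),
          IsFineFor φ A → IsFineFor ψ B →
            IsFineFor (Representation.ind (youngEmb k l) (outerTensor φ ψ)) (shuffle A B))) ∧
    -- any number of factors
    (∀ (m : ℕ) (η : Fin m → ℕ) (U : Fin m → Finset (Fin (∑ i, η i))),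
      (∀ i j, i ≠ j → Disjoint (U i) (U j)) → Finset.univ.biUnion U = Finset.univ →
      (∀ i, (U i).card = η i) →
      ∀ A : Fin m → Multiset (List (Fin (∑ i, η i))),
      (∀ i, ∀ w ∈ A i, IsPermOf (U i) w) →
        (∀ w ∈ familyShuffle A, IsPermOf Finset.univ w) ∧
        ((∀ i, (A i).Nodup) → (familyShuffle A).Nodup) ∧
        ((∀ i, IsFine (A i)) →
          IsFine (familyShuffle A) ∧ Q (familyShuffle A) = ∏ i, Q (A i)) ∧
        (∀ (M : Fin m → Type*) [∀ i, AddCommGroup (M i)] [∀ i, Module ℂ (M i)]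
          [∀ i, FiniteDimensional ℂ (M i)]
          (φ : ∀ i, Representation ℂ (Equiv.Perm (Fin (η i))) (M i)),
          (∀ i, IsFineFor (φ i) (A i)) →
            IsFineFor (Representation.ind (familyYoungEmb η) (familyOuterTensor φ))
              (familyShuffle A))) := by
  refine ⟨fun k l U V hUV hcov _ _ A B hA hB => ?_, fun m η U hdisj hcov _ A hA => ?_⟩
  · have hcov' : ∀ a, a ∈ U ∨ a ∈ V := fun a => by
      rw [← Finset.mem_union, hcov]; exact Finset.mem_univ a
    have hQ := Q_shuffle hUV hcov' hA hB
    refine ⟨isPermOf_of_mem_shuffle hUV hcov' hA hB, nodup_shuffle hA hB,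
      fun hA' hB' => ⟨hA'.of_Q_eq_mul hB' hQ, hQ⟩, ?_⟩
    intro M N _ _ _ _ _ _ φ ψ hφ hψ
    rw [IsFineFor, frobeniusCh_ind_outerTensor, hQ, hφ, hψ]
  · have hdisj' : ∀ i j a, a ∈ U i → a ∈ U j → i = j := fun i j a hi hj => by
      by_contra hne
      exact Finset.disjoint_left.1 (hdisj i j hne) hi hj
    have hcov' : ∀ a, ∃ i, a ∈ U i := fun a => by
      simpa using (Finset.ext_iff.1 hcov a).2 (Finset.mem_univ a)
    have hQ := Q_familyShuffle hdisj' hcov' hA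
    refine ⟨isPermOf_of_mem_familyShuffle hdisj' hcov' hA, nodup_familyShuffle hA,
      fun hA' => ⟨IsFine.of_Q_eq_prod hA' hQ, hQ⟩, ?_⟩
    intro M _ _ _ φ hφ
    rw [IsFineFor, frobeniusCh_ind_familyOuterTensor, hQ]
    exact Finset.prod_congr rfl fun i _ => hφ i
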